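/- Let $d,N\ge 0$, $\hbar=1$, and let a system $(S)$ with Hilbert space $L^2(\mathbb R^d)$ and phase space variable $z=(x,\xi)\in\mathbb R^{2d}$ be coupled to an environment $(E)$ with Hilbert space $L^2(\mathbb R^N)$ and phase space variable $u=(y,\eta)\in\mathbb R^{2N}$. Let the total Hamiltonian $\hat H(t)$ on $L^2(\mathbb R^d)\otimes L^2(\mathbb R^N)=L^2(\mathbb R^{d}\times\mathbb R^{N})$ be the Weyl quantization of the (possibly time-dependent) quadratic form $$H(t,z,u)=\tfrac12\, z\cdot M_S(t)z+\tfrac12\, u\cdot M_E(t)u+z\cdot G(t)u ,$$ where $M_S(t)$, $M_E(t)$, $G(t)$ are real matrices of sizes $2d\times 2d$, $2N\times 2N$, $2d\times 2N$ depending continuously on $t\in\mathbb R$ (for a time-independent Hamiltonian they are constant). Let $U(t)$ be its unitary propagator, $i\,\partial_tU(t)=\hat H(t)U(t)$, $U(0)=\mathbb I$ (so $U(t)=e^{-it\hat H}$ in the time-independent case). Write $G=G(0)$ and let $J_S=\begin{pmatrix}0&\mathbb I_d\\-\mathbb I_d&0\end{pmatrix}$, $J_E=\begin{pmatrix}0&\mathbb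 I_N\\-\mathbb I_N&0\end{pmatrix}$. A density matrix is a positive operator of trace one. A density matrix on $L^2(\mathbb R^n)$ is called a Gaussian state with covariance matrix $\Gamma$ (real, symmetric, positive definite, $2n\times 2n$) and mean $m\in\mathbb R^{2n}$ if its Weyl symbol is $\det(\Gamma)^{-1/2}\exp\!\big(-\tfrac12 (z-m)\cdot\Gamma^{-1}(z-m)\big)$. Let $\hat\rho(0)=\hat\rho_S(0)\otimes\hat\rho_E(0)$, where $\hat\rho_S(0)$ and $\hat\rho_E(0)$ are Gaussian states with covariance matrices $\Gamma_S$ and $\Gamma_E$ and arbitrary means, and put $\hat\rho(t)=U(t)\hat\rho(0)U(t)^*$, $\hat\rho_S(t)=\mathrm{tr}_E\,\hat\rho(t)$, $\hat\rho_E(t)=\mathrm{tr}_S\,\hat\rho(t)$ (partial traces). If $$J_S\Gamma_S\,G\,J_E\Gamma_E^{-1}+G\neq 0,$$ then there exists $\varepsilon>0$ such that for every $t\in(0,\varepsilon]$ $$\hat\rho(t)\neq\hat\rho_S(t)\otimes\hat\rho_E(t).$$ -/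

import Mathlib

open MeasureTheory SchwartzMap
open scoped Matrix LineDeriv InnerProductSpace

noncomputable section

/-! ### Hilbert spaces, product vectors, product operators, density matrices, reduced states -/

/-- The configuration space `ℝⁿ`. -/
abbrev Conf (n : ℕ) : Type := EuclideanSpace ℝ (Fin n)

/-- The index set of the coordinates of the phase space `ℝ²ⁿ`: `Sum.inl j` is the index of the
position `x_j` and `Sum.inr j` the index of the momentum `ξ_j`. -/
abbrev PhaseIdx (n : ℕ) : Type := Fin n ⊕ Fin n

/-- The Hilbert space `L²(X)`. The Hilbert space of the total system, `L²(ℝᵈ) ⊗ L²(ℝᴺ)`, is realised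
as `L²(ℝᵈ × ℝᴺ)`. -/
abbrev L2 (X : Type) [MeasureSpace X] : Type := Lp ℂ 2 (volume : Measure X)

set_option linter.unusedSectionVars false

section Tensor

variable {X Y : Type} [MeasureSpace X] [MeasureSpace Y]
  [SFinite (volume : Measure X)] [SFinite (volume : Measure Y)]

theorem memLp_tensor (f : L2 X) (g : L2 Y) :
    MemLp (fun p : X × Y => f p.1 * g p.2) 2 (volume : Measure (X × Y)) := by
  have hm : AEStronglyMeasurable (fun p : X × Y => f p.1 * g p.2) volume :=
    (Lp.aestronglyMeasurable f).comp_fst.mul (Lp.aestronglyMeasurable g).comp_snd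
  rw [memLp_two_iff_integrable_sq_norm hm]
  have hf := (memLp_two_iff_integrable_sq_norm (Lp.aestronglyMeasurable f)).1 (Lp.memLp f)
  have hg := (memLp_two_iff_integrable_sq_norm (Lp.aestronglyMeasurable g)).1 (Lp.memLp g)
  have h := hf.mul_prod hg
  refine h.congr (Filter.Eventually.of_forall fun p => ?_)
  simp [mul_pow]

/-- The product vector `f ⊗ g`, that is the function `(x, y) ↦ f x * g y`. -/
def tensorVec (f : L2 X) (g : L2 Y) : L2 (X × Y) := (memLp_tensor f g).toLp _

theorem coeFn_tensorVec (f : L2 X) (g : L2 Y) :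
    tensorVec f g =ᵐ[volume] fun p : X × Y => f p.1 * g p.2 :=
  (memLp_tensor f g).coeFn_toLp

theorem norm_sq_L2 {Z : Type} [MeasureSpace Z] (f : L2 Z) : ‖f‖ ^ 2 = ∫ z, ‖f z‖ ^ 2 := by
  have h := L2.inner_def (𝕜 := ℂ) f f
  have h2 : (∫ z, inner ℂ (f z) (f z)) = ((∫ z, ‖f z‖ ^ 2 : ℝ) : ℂ) := by
    rw [← integral_complex_ofReal]
    refine integral_congr_ae (Filter.Eventually.of_forall fun z => ?_)
    simp only [inner_self_eq_norm_sq_to_K]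
    norm_cast
  rw [h2, inner_self_eq_norm_sq_to_K] at h
  have h3 : ((‖f‖ ^ 2 : ℝ) : ℂ) = ((∫ z, ‖f z‖ ^ 2 : ℝ) : ℂ) := by
    rw [← h]; simp
  exact Complex.ofReal_injective h3

theorem norm_tensorVec (f : L2 X) (g : L2 Y) : ‖tensorVec f g‖ = ‖f‖ * ‖g‖ := by
  have h : ‖tensorVec f g‖ ^ 2 = (‖f‖ * ‖g‖) ^ 2 := by
    rw [mul_pow, norm_sq_L2, norm_sq_L2, norm_sq_L2, ← integral_prod_mul]
    refine integral_congr_ae ?_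
    filter_upwards [coeFn_tensorVec f g] with p hp
    rw [hp, norm_mul, mul_pow]
  exact (pow_left_inj₀ (norm_nonneg _) (by positivity) two_ne_zero).1 h

theorem ae_fst {p : X → Prop} (h : ∀ᵐ x, p x) : ∀ᵐ q : X × Y, p q.1 :=
  Measure.quasiMeasurePreserving_fst.ae h

theorem ae_snd {p : Y → Prop} (h : ∀ᵐ y, p y) : ∀ᵐ q : X × Y, p q.2 :=
  Measure.quasiMeasurePreserving_snd.ae h

/-- The bounded operator `f ↦ f ⊗ g` from `L²(X)` to `L²(X × Y)`. -/
def tensorRight (g : L2 Y) : L2 X →L[ℂ] L2 (X × Y) :=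
  LinearMap.mkContinuous
    { toFun := fun f => tensorVec f g
      map_add' := fun f f' => by
        apply Lp.ext
        filter_upwards [coeFn_tensorVec (f + f') g, coeFn_tensorVec f g, coeFn_tensorVec f' g,
          Lp.coeFn_add (tensorVec f g) (tensorVec f' g), ae_fst (Y := Y) (Lp.coeFn_add f f')]
          with p h1 h2 h3 h4 h5
        simp only [h1, h4, Pi.add_apply, h2, h3, h5, add_mul]
      map_smul' := fun c f => by
        apply Lp.ext
        filter_upwards [coeFn_tensorVec (c • f) g, coeFn_tensorVec f g,
          Lp.coeFn_smul c (tensorVec f g), ae_fst (Y := Y) (Lp.coeFn_smul c f)]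
          with p h1 h2 h3 h4
        simp only [RingHom.id_apply, h1, h3, Pi.smul_apply, h2, h4, smul_eq_mul, mul_assoc] }
    ‖g‖ (fun f => by
      change ‖tensorVec f g‖ ≤ ‖g‖ * ‖f‖
      rw [norm_tensorVec, mul_comm])

/-- The bounded operator `g ↦ f ⊗ g` from `L²(Y)` to `L²(X × Y)`. -/
def tensorLeft (f : L2 X) : L2 Y →L[ℂ] L2 (X × Y) :=
  LinearMap.mkContinuous
    { toFun := fun g => tensorVec f g
      map_add' := fun g g' => by
        apply Lp.ext
        filter_upwards [coeFn_tensorVec f (g + g'), coeFn_tensorVec f g, coeFn_tensorVec f g',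
          Lp.coeFn_add (tensorVec f g) (tensorVec f g'), ae_snd (X := X) (Lp.coeFn_add g g')]
          with p h1 h2 h3 h4 h5
        simp only [h1, h4, Pi.add_apply, h2, h3, h5, mul_add]
      map_smul' := fun c g => by
        apply Lp.ext
        filter_upwards [coeFn_tensorVec f (c • g), coeFn_tensorVec f g,
          Lp.coeFn_smul c (tensorVec f g), ae_snd (X := X) (Lp.coeFn_smul c g)]
          with p h1 h2 h3 h4
        simp only [RingHom.id_apply, h1, h3, Pi.smul_apply, h2, h4, smul_eq_mul]
        ring }
    ‖f‖ (fun g => by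
      change ‖tensorVec f g‖ ≤ ‖f‖ * ‖g‖
      rw [norm_tensorVec])

/-- `T = A ⊗ B`: the bounded operator `T` on `L²(X × Y)` acts on product vectors by
`T (f ⊗ g) = A f ⊗ B g`. This determines `T`, the product vectors being total. -/
def IsTensorOp (T : L2 (X × Y) →L[ℂ] L2 (X × Y)) (A : L2 X →L[ℂ] L2 X) (B : L2 Y →L[ℂ] L2 Y) :
    Prop :=
  ∀ (f : L2 X) (g : L2 Y), T (tensorVec f g) = tensorVec (A f) (B g)

/-- The index set of a chosen orthonormal basis of `L²(X)`. -/
def basisIdx (X : Type) [MeasureSpace X] : Set (L2 X) := (exists_hilbertBasis ℂ (L2 X)).choose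

/-- A chosen orthonormal basis of `L²(X)`. The notions below do not depend on the choice. -/
def onb (X : Type) [MeasureSpace X] : HilbertBasis (basisIdx X) ℂ (L2 X) :=
  (exists_hilbertBasis ℂ (L2 X)).choose_spec.choose

/-- Density matrices: positive operators of trace one. -/
def IsDensityMatrix {Z : Type} [MeasureSpace Z] (ρ : L2 Z →L[ℂ] L2 Z) : Prop :=
  ρ.IsPositive ∧ HasSum (fun k => ⟪onb Z k, ρ (onb Z k)⟫_ℂ) 1

/-- The partial trace over the second factor, `tr_E ρ = ∑ₖ (1 ⊗ ⟨eₖ|) ρ (1 ⊗ |eₖ⟩)` for an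
orthonormal basis `(eₖ)` of `L²(Y)`. For a density matrix (more generally a trace-class operator) `ρ`
the series converges absolutely in operator norm, and
`⟨ψ, (tr_E ρ) φ⟩ = ∑ₖ ⟨ψ ⊗ eₖ, ρ (φ ⊗ eₖ)⟩`. -/
def partialTraceSnd (ρ : L2 (X × Y) →L[ℂ] L2 (X × Y)) : L2 X →L[ℂ] L2 X :=
  ∑' k, (tensorRight (X := X) (onb Y k)).adjoint ∘L ρ ∘L tensorRight (X := X) (onb Y k)

/-- The partial trace over the first factor, `tr_S ρ = ∑ₖ (⟨eₖ| ⊗ 1) ρ (|eₖ⟩ ⊗ 1)` for an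
orthonormal basis `(eₖ)` of `L²(X)`. -/
def partialTraceFst (ρ : L2 (X × Y) →L[ℂ] L2 (X × Y)) : L2 Y →L[ℂ] L2 Y :=
  ∑' k, (tensorLeft (Y := Y) (onb X k)).adjoint ∘L ρ ∘L tensorLeft (Y := Y) (onb X k)

end Tensor

/-! ### Gaussian states -/

/-- The matrix `J` of the canonical symplectic form `σ(z, z') = z ⬝ J z'` of `ℝ²ⁿ`, so that Hamilton's
equations are `ż = J ∇H(z)`. -/
def symplJ (n : ℕ) : Matrix (PhaseIdx n) (PhaseIdx n) ℝ := Matrix.fromBlocks 0 1 (-1) 0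

/-- `A` is the Weyl quantization (`ħ = 1`) of the symbol `a`, taken here integrable in the momentum:
`(A φ)(x) = (2π)⁻ⁿ ∫∫ exp(i (x - y)·ξ) a((x + y)/2, ξ) φ(y) dy dξ` for Schwartz functions `φ`. -/
def HasWeylSymbol {n : ℕ} (A : L2 (Conf n) →L[ℂ] L2 (Conf n)) (a : (PhaseIdx n → ℝ) → ℝ) : Prop :=
  ∀ φ : 𝓢(Conf n, ℂ), A (φ.toLp 2) =ᵐ[volume] fun x : Conf n =>
    ((2 * Real.pi : ℝ) : ℂ)⁻¹ ^ n * ∫ q : Conf n × Conf n,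
      Complex.exp (Complex.I * ((inner ℝ (x - q.1) q.2 : ℝ) : ℂ)) *
        (a (Sum.elim (fun j => (x j + q.1 j) / 2) (fun j => q.2 j)) : ℂ) * φ q.1

/-- The Gaussian symbol `ρ^{Γ,m}(z) = det(Γ)^{-1/2} exp(-½ (z - m)·Γ⁻¹(z - m))`. -/
def gaussianSymbol {n : ℕ} (Γ : Matrix (PhaseIdx n) (PhaseIdx n) ℝ) (m : PhaseIdx n → ℝ)
    (z : PhaseIdx n → ℝ) : ℝ :=
  (Real.sqrt Γ.det)⁻¹ * Real.exp (-(1 / 2) * ((z - m) ⬝ᵥ (Γ⁻¹ *ᵥ (z - m))))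

/-- `ρ` is a Gaussian state with covariance matrix `Γ` (positive definite) and mean `m`: a density
matrix whose Weyl symbol is `ρ^{Γ,m}`. -/
structure IsGaussianState {n : ℕ} (ρ : L2 (Conf n) →L[ℂ] L2 (Conf n))
    (Γ : Matrix (PhaseIdx n) (PhaseIdx n) ℝ) (m : PhaseIdx n → ℝ) : Prop where
  posDef : Γ.PosDef
  density : IsDensityMatrix ρ
  symbol : HasWeylSymbol ρ (gaussianSymbol Γ m)

/-! ### Quadratic Hamiltonians and their propagators -/

section Quantization

variable {E : Type} [NormedAddCommGroup E] [NormedSpace ℝ E]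

/-- Multiplication by the linear form `ℓ`. -/
def positionOp (l : E →L[ℝ] ℝ) : 𝓢(E, ℂ) →L[ℂ] 𝓢(E, ℂ) :=
  SchwartzMap.smulLeftCLM ℂ (fun x => (l x : ℂ))

/-- The momentum `-i ∂_v` in the direction `v`. -/
def momentumOp (v : E) : 𝓢(E, ℂ) →L[ℂ] 𝓢(E, ℂ) :=
  (-Complex.I) • LineDeriv.lineDerivOpCLM ℂ 𝓢(E, ℂ) v

/-- The Weyl quantization of the quadratic form `½ X·M X` in phase space coordinates `X_a` whose
quantizations are the operators `Q a`: the symbol `X_a X_b` is quantized as `½ (Q_a Q_b + Q_b Q_a)`. -/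
def weylQuadratic {κ : Type} [Fintype κ] (Q : κ → 𝓢(E, ℂ) →L[ℂ] 𝓢(E, ℂ)) (M : Matrix κ κ ℝ) :
    𝓢(E, ℂ) →L[ℂ] 𝓢(E, ℂ) :=
  ∑ a, ∑ b, ((M a b / 4 : ℝ) : ℂ) • (Q a ∘L Q b + Q b ∘L Q a)

/-- `U t = U(t, 0)` is the quantum propagator of the time-dependent Hamiltonian `H t`: unitary
operators with `U 0 = 1` that solve `i ∂ₜ U(t) = H(t) U(t)`, tested against Schwartz functions. -/
structure IsPropagator [MeasureSpace E] [BorelSpace E] [SecondCountableTopology E]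
    [(volume : Measure E).HasTemperateGrowth]
    (H : ℝ → 𝓢(E, ℂ) →L[ℂ] 𝓢(E, ℂ)) (U : ℝ → L2 E →L[ℂ] L2 E) : Prop where
  isUnitary : ∀ t, U t ∈ unitary (L2 E →L[ℂ] L2 E)
  zero : U 0 = 1
  schrodinger : ∀ (φ : 𝓢(E, ℂ)) (f : L2 E) (t : ℝ),
    HasDerivAt (fun s => ⟪φ.toLp 2, U s f⟫_ℂ)
      (-Complex.I * ⟪(H t φ).toLp 2, U t f⟫_ℂ) t

end Quantization

instance instHasTemperateGrowthProd (d N : ℕ) :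
    (volume : Measure (Conf d × Conf N)).HasTemperateGrowth := by
  have h : ((volume : Measure (Conf d)).prod (volume : Measure (Conf N))).IsAddHaarMeasure :=
    inferInstance
  rw [Measure.volume_eq_prod]
  exact Measure.IsAddHaarMeasure.instHasTemperateGrowth

/-- Quantized phase space coordinates of the system, acting on functions of `(x, y) ∈ ℝᵈ × ℝᴺ`:
multiplication by `x_j` and `-i ∂/∂x_j`. -/
def systemOp (d N : ℕ) : PhaseIdx d → 𝓢(Conf d × Conf N, ℂ) →L[ℂ] 𝓢(Conf d × Conf N, ℂ) :=
  Sum.elim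
    (fun j => positionOp ((EuclideanSpace.proj j : Conf d →L[ℝ] ℝ) ∘L
      ContinuousLinearMap.fst ℝ (Conf d) (Conf N)))
    (fun j => momentumOp (EuclideanSpace.single j 1, 0))

/-- Quantized phase space coordinates of the environment, acting on functions of
`(x, y) ∈ ℝᵈ × ℝᴺ`: multiplication by `y_k` and `-i ∂/∂y_k`. -/
def environmentOp (d N : ℕ) : PhaseIdx N → 𝓢(Conf d × Conf N, ℂ) →L[ℂ] 𝓢(Conf d × Conf N, ℂ) :=
  Sum.elim
    (fun k => positionOp ((EuclideanSpace.proj k : Conf N →L[ℝ] ℝ) ∘L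
      ContinuousLinearMap.snd ℝ (Conf d) (Conf N)))
    (fun k => momentumOp (0, EuclideanSpace.single k 1))

/-- The Weyl quantization of the total Hamiltonian
`H(z, u) = ½ z·M_S z + ½ u·M_E u + z·G u` with `z ∈ ℝ²ᵈ`, `u ∈ ℝ²ᴺ`. -/
def totalHamiltonian {d N : ℕ} (MS : Matrix (PhaseIdx d) (PhaseIdx d) ℝ)
    (ME : Matrix (PhaseIdx N) (PhaseIdx N) ℝ) (G : Matrix (PhaseIdx d) (PhaseIdx N) ℝ) :
    𝓢(Conf d × Conf N, ℂ) →L[ℂ] 𝓢(Conf d × Conf N, ℂ) :=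
  weylQuadratic (Sum.elim (systemOp d N) (environmentOp d N)) (Matrix.fromBlocks MS G Gᵀ ME)

/-- The state `ρ(t) = U(t) ρ(0) U(t)*`. -/
def evolvedState {H : Type} [NormedAddCommGroup H] [InnerProductSpace ℂ H] [CompleteSpace H]
    (U : ℝ → H →L[ℂ] H) (ρ₀ : H →L[ℂ] H) (t : ℝ) : H →L[ℂ] H :=
  U t ∘L ρ₀ ∘L (U t).adjoint

end

/-! A product operator `A ⊗ B` has matrix elements that factor on product vectors, so all its 2 × 2
minors in the system and environment indices vanish. If the evolved state were a product at
arbitrarily small positive times, every minor would vanish at times accumulating at 0. Each minor is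
differentiable at 0, so its derivative is zero there. Hence the time derivative `-i[H, ρ₀]` of the
state, as a form on Schwartz functions, is tangent to the product forms at `r ⊗ s`: it has the shape
`α ⊗ s + r ⊗ β`, where `r` and `s` are the forms of `ρS` and `ρE`.

The local Hamiltonians contribute terms of exactly this shape, so only the coupling matters.
Commuting a canonical coordinate with a Gaussian state takes a Poisson bracket of its Weyl symbol,
and the gradient of a Gaussian is linear in `z - m` times the Gaussian. Therefore `[Q_a, r] = -i ∑
(JΓ⁻¹)_{ab} D_b r`, where `D_b` is symmetrized multiplication by the centred coordinate
(`IsGaussianState.isGaussianForm`). Substituting this turns the coupling commutator, up to tangent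
terms, into a combination of the forms `D_c r ⊗ D_e s` with coefficient matrix `-i(G J_E Γ_E⁻¹ -
Γ_S⁻¹ J_S G)` (`IsGaussianForm.sum_commutator_eq`).

The forms `D_c r`, together with `r`, are linearly independent by the canonical commutation
relations, so tangency forces the matrix to vanish (`IsGaussianForm.eq_zero_of_tangent`). Left
multiplication by `J_S Γ_S` then contradicts the assumed condition. The argument never identifies
the factors `A` and `B`, so nothing about partial traces is needed. -/

/-! ### Algebra of forms with Gaussian commutators -/

section GaussianForm

variable {V : Type*} [AddCommGroup V] [Module ℂ V] {κ : Type*} [Fintype κ]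

/-- Symmetrized multiplication of a form by the centred coordinate `X_a - m_a`. -/
noncomputable def symMul (Q : κ → V →ₗ[ℂ] V) (m : κ → ℝ) (a : κ) (B : V → V → ℂ) (ψ φ : V) : ℂ :=
  (B (Q a ψ) φ + B ψ (Q a φ)) / 2 - m a * B ψ φ

/-- A sesquilinear form `r` whose commutators with canonical coordinates `Q` are the linear
combinations, with matrix `K`, of the symmetrized products of `r` with centred coordinates. -/
structure IsGaussianForm (Q : κ → V →ₗ[ℂ] V) (m : κ → ℝ) (J K : Matrix κ κ ℝ)
    (r : V →ₗ⋆[ℂ] V →ₗ[ℂ] ℂ) : Prop where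
  ccr : ∀ a b φ, Q a (Q b φ) - Q b (Q a φ) = (Complex.I * J a b) • φ
  commutator : ∀ a ψ φ, r (Q a ψ) φ - r ψ (Q a φ) =
    -Complex.I * ∑ b, (K a b : ℂ) * symMul Q m b (fun ψ φ => r ψ φ) ψ φ
  ne_zero : ∃ ψ φ, r ψ φ ≠ 0

variable {Q : κ → V →ₗ[ℂ] V} {m : κ → ℝ} {J K : Matrix κ κ ℝ} {r : V →ₗ⋆[ℂ] V →ₗ[ℂ] ℂ}

/-- The commutator `[Q_b, Q_c]` is a scalar, and it enters the two slots of the form with opposite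
signs (the first slot is antilinear), so its contributions cancel. This reflects that
multiplications of a Weyl symbol by coordinates commute. -/
theorem IsGaussianForm.symMul_comm (h : IsGaussianForm Q m J K r) (b c : κ) (ψ φ : V) :
    symMul Q m c (symMul Q m b fun ψ φ => r ψ φ) ψ φ =
      symMul Q m b (symMul Q m c fun ψ φ => r ψ φ) ψ φ := by
  have h1 : r (Q b (Q c ψ)) φ - r (Q c (Q b ψ)) φ = -(Complex.I * J b c) * r ψ φ := by
    have := congrArg (fun x => r x φ) (h.ccr b c ψ)
    simpa using this
  have h2 : r ψ (Q b (Q c φ)) - r ψ (Q c (Q b φ)) = (Complex.I * J b c) * r ψ φ := by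
    have := congrArg (fun x => r ψ x) (h.ccr b c φ)
    simpa using this
  simp only [symMul]
  linear_combination (1 / 4 : ℂ) * h1 + (1 / 4 : ℂ) * h2

/-- Leibniz rule: commuting `Q_a` past `D_c` costs the scalar `i J_{ac}`, and what remains is `D_c`
applied to `[Q_a, r]`, which the Gaussian relation expands. -/
theorem IsGaussianForm.symMul_commutator (h : IsGaussianForm Q m J K r) (a c : κ) (ψ φ : V) :
    symMul Q m c (fun ψ φ => r ψ φ) (Q a ψ) φ - symMul Q m c (fun ψ φ => r ψ φ) ψ (Q a φ) =
      Complex.I * J a c * r ψ φ -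
        Complex.I * ∑ b, (K a b : ℂ) * symMul Q m c (symMul Q m b fun ψ φ => r ψ φ) ψ φ := by
  have h1 : r (Q a (Q c ψ)) φ - r (Q c (Q a ψ)) φ = -(Complex.I * J a c) * r ψ φ := by
    have := congrArg (fun x => r x φ) (h.ccr a c ψ)
    simpa using this
  have h2 : r ψ (Q a (Q c φ)) - r ψ (Q c (Q a φ)) = (Complex.I * J a c) * r ψ φ := by
    have := congrArg (fun x => r ψ x) (h.ccr a c φ)
    simpa using this
  have h3 := h.commutator a (Q c ψ) φ
  have h4 := h.commutator a ψ (Q c φ)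
  have h5 := h.commutator a ψ φ
  have h6 : ∑ b, (K a b : ℂ) * symMul Q m c (symMul Q m b fun ψ φ => r ψ φ) ψ φ =
      ((∑ b, (K a b : ℂ) * symMul Q m b (fun ψ φ => r ψ φ) (Q c ψ) φ) +
        ∑ b, (K a b : ℂ) * symMul Q m b (fun ψ φ => r ψ φ) ψ (Q c φ)) / 2 -
      m c * ∑ b, (K a b : ℂ) * symMul Q m b (fun ψ φ => r ψ φ) ψ φ := by
    rw [← Finset.sum_add_distrib, Finset.sum_div, Finset.mul_sum, ← Finset.sum_sub_distrib]
    refine Finset.sum_congr rfl fun b _ => ?_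
    rw [symMul]
    ring
  rw [h6]
  simp only [symMul] at *
  linear_combination (-1 / 2 : ℂ) * h1 + (1 / 2 : ℂ) * h2 + (1 / 2 : ℂ) * h3 +
    (1 / 2 : ℂ) * h4 - (m c : ℂ) * h5

/-- Linear independence of the `D_c r` and `r`. Taking the commutator of the relation with `Q_a`,
the quadratic terms `D_c D_b r` reduce, by commutativity and the relation itself, to `α₀ [Q_a, r]`
and cancel the right-hand side. Only `i (Jα)_a r` is left, and `r` is nonzero while `J` is
injective. -/
theorem IsGaussianForm.eq_zero_of_sum_symMul (h : IsGaussianForm Q m J K r)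
    (hJ : ∀ x : κ → ℂ, (∀ a, ∑ c, (J a c : ℂ) * x c = 0) → x = 0) {α : κ → ℂ} {α₀ : ℂ}
    (hα : ∀ ψ φ, ∑ c, α c * symMul Q m c (fun ψ φ => r ψ φ) ψ φ = α₀ * r ψ φ) : α = 0 := by
  obtain ⟨ψ, φ, hr⟩ := h.ne_zero
  refine hJ α fun a => ?_
  have e1 : ∀ b, ∑ c, α c * symMul Q m c (symMul Q m b fun ψ φ => r ψ φ) ψ φ =
      α₀ * symMul Q m b (fun ψ φ => r ψ φ) ψ φ := by
    intro b
    have : ∀ c, α c * symMul Q m c (symMul Q m b fun ψ φ => r ψ φ) ψ φ =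
        (α c * symMul Q m c (fun ψ φ => r ψ φ) (Q b ψ) φ +
          α c * symMul Q m c (fun ψ φ => r ψ φ) ψ (Q b φ)) / 2 -
          m b * (α c * symMul Q m c (fun ψ φ => r ψ φ) ψ φ) := by
      intro c
      rw [h.symMul_comm, symMul]
      ring
    simp only [this]
    rw [Finset.sum_sub_distrib, ← Finset.sum_div, Finset.sum_add_distrib, ← Finset.mul_sum,
      hα, hα, hα]
    simp only [symMul]
    ring
  have e2 : ∑ c, α c * (symMul Q m c (fun ψ φ => r ψ φ) (Q a ψ) φ -
      symMul Q m c (fun ψ φ => r ψ φ) ψ (Q a φ)) = α₀ * (r (Q a ψ) φ - r ψ (Q a φ)) := by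
    simp only [mul_sub, Finset.sum_sub_distrib, hα]
  have e3 : ∑ c, α c * (Complex.I * ∑ b, (K a b : ℂ) *
      symMul Q m c (symMul Q m b fun ψ φ => r ψ φ) ψ φ) = Complex.I * ∑ b, (K a b : ℂ) *
      (α₀ * symMul Q m b (fun ψ φ => r ψ φ) ψ φ) := by
    simp only [← e1, Finset.mul_sum]
    rw [Finset.sum_comm]
    refine Finset.sum_congr rfl fun b _ => Finset.sum_congr rfl fun c _ => by ring
  have e4 : ∑ b, (K a b : ℂ) * (α₀ * symMul Q m b (fun ψ φ => r ψ φ) ψ φ) =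
      α₀ * ∑ b, (K a b : ℂ) * symMul Q m b (fun ψ φ => r ψ φ) ψ φ := by
    rw [Finset.mul_sum]
    exact Finset.sum_congr rfl fun b _ => by ring
  have e5 : ∑ c, α c * (Complex.I * J a c * r ψ φ) =
      Complex.I * r ψ φ * ∑ c, (J a c : ℂ) * α c := by
    rw [Finset.mul_sum]
    exact Finset.sum_congr rfl fun b _ => by ring
  simp only [h.symMul_commutator, h.commutator a ψ φ] at e2
  simp only [mul_sub, Finset.sum_sub_distrib, e5] at e2
  rw [e3, e4] at e2
  have : Complex.I * r ψ φ * ∑ c, (J a c : ℂ) * α c = 0 := by linear_combination e2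
  exact (mul_eq_zero.1 this).resolve_left (mul_ne_zero Complex.I_ne_zero hr)

/-- A combination of products of symmetrized forms is tangent to the product forms at `r ⊗ s` only
if its coefficient matrix vanishes. -/
theorem IsGaussianForm.eq_zero_of_tangent {W : Type*} [AddCommGroup W] [Module ℂ W]
    {ι : Type*} [Fintype ι] {P : ι → W →ₗ[ℂ] W} {n : ι → ℝ} {J' L : Matrix ι ι ℝ}
    {s : W →ₗ⋆[ℂ] W →ₗ[ℂ] ℂ} (h : IsGaussianForm Q m J K r) (h' : IsGaussianForm P n J' L s)
    (hJ : ∀ x : κ → ℂ, (∀ a, ∑ c, (J a c : ℂ) * x c = 0) → x = 0)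
    (hJ' : ∀ x : ι → ℂ, (∀ a, ∑ c, (J' a c : ℂ) * x c = 0) → x = 0)
    {M : Matrix κ ι ℂ} {α : V → V → ℂ} {β : W → W → ℂ}
    (hM : ∀ ψ φ χ ω, ∑ c, ∑ e, M c e * (symMul Q m c (fun ψ φ => r ψ φ) ψ φ *
      symMul P n e (fun ψ φ => s ψ φ) χ ω) = α ψ φ * s χ ω + r ψ φ * β χ ω) : M = 0 := by
  obtain ⟨χ₀, ω₀, hs⟩ := h'.ne_zero
  set D := fun c => symMul Q m c (fun ψ φ => r ψ φ) with hD
  set F := fun e => symMul P n e (fun ψ φ => s ψ φ) with hF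
  have key : ∀ χ ω ψ φ, ∑ c, (∑ e, M c e * F e χ ω) * D c ψ φ =
      α ψ φ * s χ ω + r ψ φ * β χ ω := by
    intro χ ω ψ φ
    rw [← hM]
    refine Finset.sum_congr rfl fun c _ => ?_
    rw [Finset.sum_mul]
    exact Finset.sum_congr rfl fun e _ => by ring
  -- Subtracting `s χ ω / s χ₀ ω₀` times the relation at `(χ₀, ω₀)` eliminates the unknown `α`. What
  -- is left is a combination of the `D_c r` equal to a multiple of `r`, so each coefficient
  -- vanishes. That is in turn a relation among the `F_e` and `s`, to which independence on the
  -- other factor applies.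
  have step : ∀ χ ω c, ∑ e, M c e * F e χ ω = (∑ e, M c e * F e χ₀ ω₀) / s χ₀ ω₀ * s χ ω := by
    intro χ ω c
    have hz := h.eq_zero_of_sum_symMul hJ
      (α := fun c => ∑ e, M c e * F e χ ω - (∑ e, M c e * F e χ₀ ω₀) / s χ₀ ω₀ * s χ ω)
      (α₀ := β χ ω - β χ₀ ω₀ / s χ₀ ω₀ * s χ ω) (fun ψ φ => by
        have k1 := key χ ω ψ φ
        have k2 := key χ₀ ω₀ ψ φ
        have : ∑ c, (∑ e, M c e * F e χ ω - (∑ e, M c e * F e χ₀ ω₀) / s χ₀ ω₀ * s χ ω) * D c ψ φ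
            = ∑ c, (∑ e, M c e * F e χ ω) * D c ψ φ -
              s χ ω / s χ₀ ω₀ * ∑ c, (∑ e, M c e * F e χ₀ ω₀) * D c ψ φ := by
          rw [Finset.mul_sum, ← Finset.sum_sub_distrib]
          exact Finset.sum_congr rfl fun c _ => by ring
        refine this.trans ?_
        rw [k1, k2]
        field_simp
        ring)
    exact sub_eq_zero.1 (congrFun hz c)
  ext c e
  have := h'.eq_zero_of_sum_symMul hJ' (α := fun e => M c e) (fun χ ω => step χ ω c)
  exact congrFun this e

end GaussianForm

/-! ### Differentiating the evolved state at time zero -/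

section Evolution

variable {H : Type*} [NormedAddCommGroup H] [InnerProductSpace ℂ H]

theorem norm_le_of_norm_inner_le {x : H} {C : ℝ} (hC : 0 ≤ C)
    (h : ∀ f : H, ‖⟪x, f⟫_ℂ‖ ≤ C * ‖f‖) : ‖x‖ ≤ C := by
  rcases eq_or_ne x 0 with rfl | hx
  · simpa
  · have h1 := h x
    rw [inner_self_eq_norm_sq_to_K] at h1
    have h2 : ‖x‖ * ‖x‖ ≤ C * ‖x‖ := by simpa [pow_two] using h1
    exact le_of_mul_le_mul_right h2 (norm_pos_iff.2 hx)

/-- The product rule for a bounded sesquilinear form along weakly differentiable curves that are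
Lipschitz at the base point. -/
theorem hasDerivAt_inner_of_weak [CompleteSpace H] {u v : ℝ → H} {u' v' : H} (ρ : H →L[ℂ] H)
    (hu : ∀ f, HasDerivAt (fun t => ⟪u t, f⟫_ℂ) ⟪u', f⟫_ℂ 0)
    (hv : ∀ f, HasDerivAt (fun t => ⟪v t, f⟫_ℂ) ⟪v', f⟫_ℂ 0)
    {C D : ℝ} (hC : ∀ t ∈ Set.Icc (-1 : ℝ) 1, ‖u t - u 0‖ ≤ C * |t|)
    (hD : ∀ t ∈ Set.Icc (-1 : ℝ) 1, ‖v t - v 0‖ ≤ D * |t|) :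
    HasDerivAt (fun t => ⟪u t, ρ (v t)⟫_ℂ) (⟪u', ρ (v 0)⟫_ℂ + ⟪u 0, ρ v'⟫_ℂ) 0 := by
  have h1 := hu (ρ (v 0))
  have h2 : HasDerivAt (fun t => ⟪u 0, ρ (v t)⟫_ℂ) ⟪u 0, ρ v'⟫_ℂ 0 := by
    have h := (hv (ρ.adjoint (u 0))).star
    have e : ∀ w, star ⟪w, ρ.adjoint (u 0)⟫_ℂ = ⟪u 0, ρ w⟫_ℂ := by
      intro w
      rw [ContinuousLinearMap.adjoint_inner_right]
      exact inner_conj_symm _ _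
    simpa only [e] using h
  -- The mixed term is not controlled by weak differentiability alone; the Lipschitz bounds make it
  -- `O(t²)`.
  have h3 : HasDerivAt (fun t => ⟪u t - u 0, ρ (v t - v 0)⟫_ℂ) 0 0 := by
    have hO : (fun t => ⟪u t - u 0, ρ (v t - v 0)⟫_ℂ) =O[nhds 0]
        fun t : ℝ => ‖t - 0‖ ^ 2 := by
      refine Asymptotics.IsBigO.of_bound (C * (‖ρ‖ * D)) ?_
      filter_upwards [Icc_mem_nhds (show (-1 : ℝ) < 0 by norm_num) (show (0 : ℝ) < 1 by norm_num)]
        with t ht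
      have c1 := hC t ht
      have c2 : ‖ρ (v t - v 0)‖ ≤ ‖ρ‖ * (D * |t|) :=
        (ρ.le_opNorm _).trans (by gcongr; exact hD t ht)
      calc ‖⟪u t - u 0, ρ (v t - v 0)⟫_ℂ‖ ≤ ‖u t - u 0‖ * ‖ρ (v t - v 0)‖ := norm_inner_le_norm _ _
        _ ≤ (C * |t|) * (‖ρ‖ * (D * |t|)) := by
          gcongr
          exact (norm_nonneg _).trans c1
        _ = C * (‖ρ‖ * D) * ‖‖t - 0‖ ^ 2‖ := by
          simp only [sub_zero, Real.norm_eq_abs, sq_abs, abs_pow]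
          rw [← sq_abs]
          ring
    simpa using (hO.hasFDerivAt one_lt_two).hasDerivAt
  have h4 := ((h1.add h2).add h3).sub_const ⟪u 0, ρ (v 0)⟫_ℂ
  rw [add_zero] at h4
  convert! h4 using 1
  ext t
  simp only [Pi.add_apply, map_sub, inner_sub_left, inner_sub_right]
  ring

variable {E : Type} [NormedAddCommGroup E] [NormedSpace ℝ E]
  [MeasureSpace E] [BorelSpace E] [SecondCountableTopology E]
  [(volume : Measure E).HasTemperateGrowth]

/-- Weak differentiability upgrades to a norm Lipschitz bound: by unitarity the derivative of `⟪φ, U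
s f⟫` is at most `C * ‖f‖`, uniformly in `f`, so the mean value inequality and duality give the
estimate. -/
theorem IsPropagator.norm_adjoint_sub_le {Ham : ℝ → 𝓢(E, ℂ) →L[ℂ] 𝓢(E, ℂ)} {U : ℝ → L2 E →L[ℂ] L2 E}
    (hU : IsPropagator Ham U) (φ : 𝓢(E, ℂ)) {C : ℝ}
    (hC : ∀ t ∈ Set.Icc (-1 : ℝ) 1, ‖(Ham t φ).toLp 2 (volume : Measure E)‖ ≤ C) :
    ∀ t ∈ Set.Icc (-1 : ℝ) 1,
      ‖(U t).adjoint (φ.toLp 2) - (U 0).adjoint (φ.toLp 2)‖ ≤ C * |t| := by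
  intro t ht
  have h0 : (0 : ℝ) ∈ Set.Icc (-1 : ℝ) 1 := by simp
  have hC0 : 0 ≤ C := (norm_nonneg _).trans (hC 0 h0)
  refine norm_le_of_norm_inner_le (by positivity) fun f => ?_
  have hb := Convex.norm_image_sub_le_of_norm_hasDerivWithin_le (s := Set.Icc (-1 : ℝ) 1)
    (C := C * ‖f‖) (fun s _ => (hU.schrodinger φ f s).hasDerivWithinAt) (fun s hs => by
      have hn : ‖U s f‖ = ‖f‖ := ContinuousLinearMap.norm_map_of_mem_unitary (hU.isUnitary s) f
      rw [norm_mul, norm_neg, Complex.norm_I, one_mul, ← hn]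
      exact (norm_inner_le_norm _ _).trans (by gcongr; exact hC s hs))
    (convex_Icc _ _) h0 ht
  rw [inner_sub_left, ContinuousLinearMap.adjoint_inner_left,
    ContinuousLinearMap.adjoint_inner_left]
  refine hb.trans (le_of_eq ?_)
  rw [sub_zero, Real.norm_eq_abs]
  ring

/-- The von Neumann equation at time zero, tested against Schwartz functions. -/
theorem IsPropagator.hasDerivAt_evolvedState {Ham : ℝ → 𝓢(E, ℂ) →L[ℂ] 𝓢(E, ℂ)}
    {U : ℝ → L2 E →L[ℂ] L2 E} (hU : IsPropagator Ham U) (ρ : L2 E →L[ℂ] L2 E) (ψ φ : 𝓢(E, ℂ))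
    (hb : ∀ χ : 𝓢(E, ℂ), ∃ C, ∀ t ∈ Set.Icc (-1 : ℝ) 1,
      ‖(Ham t χ).toLp 2 (volume : Measure E)‖ ≤ C) :
    HasDerivAt (fun t => ⟪ψ.toLp 2, evolvedState U ρ t (φ.toLp 2)⟫_ℂ)
      (-Complex.I * (⟪(Ham 0 ψ).toLp 2, ρ (φ.toLp 2)⟫_ℂ - ⟪ψ.toLp 2, ρ ((Ham 0 φ).toLp 2)⟫_ℂ)) 0 := by
  obtain ⟨C, hC⟩ := hb ψ
  obtain ⟨D, hD⟩ := hb φ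
  -- Matrix elements of `U ρ U*` are `⟪U* ψ, ρ (U* φ)⟫`, so the relevant curves are `U* χ`, whose
  -- weak derivative at 0 is `i H χ`.
  have hw : ∀ (χ : 𝓢(E, ℂ)) (f : L2 E), HasDerivAt (fun t => ⟪(U t).adjoint (χ.toLp 2), f⟫_ℂ)
      ⟪Complex.I • (Ham 0 χ).toLp 2 (volume : Measure E), f⟫_ℂ 0 := by
    intro χ f
    have := hU.schrodinger χ f 0
    simp only [ContinuousLinearMap.adjoint_inner_left]
    rw [hU.zero] at this
    simpa [inner_smul_left] using this
  have h := hasDerivAt_inner_of_weak ρ (hw ψ) (hw φ) (hU.norm_adjoint_sub_le ψ hC)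
    (hU.norm_adjoint_sub_le φ hD)
  have hz : (U 0).adjoint = 1 := by
    rw [hU.zero, ← ContinuousLinearMap.star_eq_adjoint, star_one]
  convert! h using 1
  · ext t
    simp [evolvedState, ContinuousLinearMap.adjoint_inner_left]
  · simp only [hz, one_apply_eq_self, inner_smul_left, map_smul, inner_smul_right,
      Complex.conj_I]
    ring

end Evolution

/-! ### Tensor products of Schwartz functions -/

section SchwartzTensor

variable {E F : Type*} [NormedAddCommGroup E] [NormedSpace ℝ E]
  [NormedAddCommGroup F] [NormedSpace ℝ F]

theorem exists_pow_norm_mul_iteratedFDeriv_comp_le {G : Type*} [NormedAddCommGroup G]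
    [NormedSpace ℝ G] (L : G →L[ℝ] E) (hL : ‖L‖ ≤ 1) (f : 𝓢(E, ℂ)) (k n : ℕ) :
    ∃ C, 0 ≤ C ∧ ∀ p : G, ‖L p‖ ^ k * ‖iteratedFDeriv ℝ n (f ∘ L) p‖ ≤ C := by
  obtain ⟨C, hC, h⟩ := f.decay k n
  refine ⟨C, hC.le, fun p => le_trans ?_ (h (L p))⟩
  rw [L.iteratedFDeriv_comp_right (f.smooth n) p le_rfl]
  gcongr
  refine (ContinuousMultilinearMap.norm_compContinuousLinearMap_le _ _).trans ?_
  exact mul_le_of_le_one_right (norm_nonneg _) (Finset.prod_le_one (fun _ _ => norm_nonneg _)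
    fun _ _ => hL)

/-- The tensor product of two Schwartz functions. -/
noncomputable def schwartzTensor (f : 𝓢(E, ℂ)) (g : 𝓢(F, ℂ)) : 𝓢(E × F, ℂ) where
  toFun p := f p.1 * g p.2
  smooth' := by
    have hf := (f.smooth ⊤).comp (contDiff_fst (𝕜 := ℝ) (E := E) (F := F))
    have hg := (g.smooth ⊤).comp (contDiff_snd (𝕜 := ℝ) (E := E) (F := F))
    exact hf.mul hg
  decay' k n := by
    have hf := fun k n => exists_pow_norm_mul_iteratedFDeriv_comp_le
      (ContinuousLinearMap.fst ℝ E F) (ContinuousLinearMap.norm_fst_le ℝ E F) f k n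
    have hg := fun k n => exists_pow_norm_mul_iteratedFDeriv_comp_le
      (ContinuousLinearMap.snd ℝ E F) (ContinuousLinearMap.norm_snd_le ℝ E F) g k n
    choose A hA0 hA using hf
    choose B hB0 hB using hg
    refine ⟨∑ i ∈ Finset.range (n + 1), (n.choose i : ℝ) *
      (A k i * B 0 (n - i) + A 0 i * B k (n - i)), fun p => ?_⟩
    have hle := norm_iteratedFDeriv_mul_le (𝕜 := ℝ) (N := n)
      (f := f ∘ ContinuousLinearMap.fst ℝ E F) (g := g ∘ ContinuousLinearMap.snd ℝ E F)
      ((f.smooth n).comp (ContinuousLinearMap.contDiff _))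
      ((g.smooth n).comp (ContinuousLinearMap.contDiff _)) p le_rfl
    refine (mul_le_mul_of_nonneg_left hle (by positivity)).trans ?_
    rw [Finset.mul_sum]
    refine Finset.sum_le_sum fun i _ => ?_
    set a := ‖iteratedFDeriv ℝ i (f ∘ ContinuousLinearMap.fst ℝ E F) p‖
    set b := ‖iteratedFDeriv ℝ (n - i) (g ∘ ContinuousLinearMap.snd ℝ E F) p‖
    have h1 : ‖p.1‖ ^ k * a ≤ A k i := hA k i p
    have h2 : ‖p.2‖ ^ k * b ≤ B k (n - i) := hB k (n - i) p
    have h3 : a ≤ A 0 i := by simpa only [pow_zero, one_mul] using hA 0 i p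
    have h4 : b ≤ B 0 (n - i) := by simpa only [pow_zero, one_mul] using hB 0 (n - i) p
    -- The norm on the product is the maximum, so the weight can be charged to one factor while the
    -- other is merely bounded.
    have hp : ‖p‖ ^ k ≤ ‖p.1‖ ^ k + ‖p.2‖ ^ k := by
      rw [Prod.norm_def]
      rcases max_cases ‖p.1‖ ‖p.2‖ with h | h <;> rw [h.1] <;> simp
    have ha : 0 ≤ a := norm_nonneg _
    have hb : 0 ≤ b := norm_nonneg _
    calc ‖p‖ ^ k * ((n.choose i : ℝ) * a * b)
        ≤ (‖p.1‖ ^ k + ‖p.2‖ ^ k) * ((n.choose i : ℝ) * a * b) := by gcongr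
      _ = (n.choose i : ℝ) * ((‖p.1‖ ^ k * a) * b + a * (‖p.2‖ ^ k * b)) := by ring
      _ ≤ _ := by
        have := hA0 k i
        have := hA0 0 i
        gcongr

@[simp]
theorem schwartzTensor_apply (f : 𝓢(E, ℂ)) (g : 𝓢(F, ℂ)) (p : E × F) :
    schwartzTensor f g p = f p.1 * g p.2 := rfl

/-- The tensor product of Schwartz functions as a bilinear map. -/
noncomputable def schwartzTensorₗ : 𝓢(E, ℂ) →ₗ[ℂ] 𝓢(F, ℂ) →ₗ[ℂ] 𝓢(E × F, ℂ) :=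
  LinearMap.mk₂ ℂ schwartzTensor
    (fun f f' g => by ext p; simp [add_mul])
    (fun c f g => by ext p; simp [mul_assoc])
    (fun f g g' => by ext p; simp [mul_add])
    (fun c f g => by ext p; simp [mul_left_comm])

@[simp]
theorem schwartzTensorₗ_apply (f : 𝓢(E, ℂ)) (g : 𝓢(F, ℂ)) :
    schwartzTensorₗ f g = schwartzTensor f g := rfl

end SchwartzTensor

/-! ### Canonical coordinates and their commutation relations -/

theorem positionOp_apply {E : Type} [NormedAddCommGroup E] [NormedSpace ℝ E] (l : E →L[ℝ] ℝ)
    (f : 𝓢(E, ℂ)) (x : E) : positionOp l f x = (l x : ℂ) * f x := by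
  rw [positionOp, SchwartzMap.smulLeftCLM_apply_apply, smul_eq_mul]
  exact (Complex.ofRealCLM ∘L l).hasTemperateGrowth

theorem momentumOp_apply {E : Type} [NormedAddCommGroup E] [NormedSpace ℝ E] (v : E)
    (f : 𝓢(E, ℂ)) (x : E) : momentumOp v f x = -Complex.I * fderiv ℝ f x v := by
  simp [momentumOp, LineDeriv.lineDerivOpCLM_apply, SchwartzMap.lineDerivOp_apply_eq_fderiv]

/-- The quantized phase space coordinates on `𝓢(ℝⁿ)`. -/
noncomputable def canonicalOp (n : ℕ) : PhaseIdx n → 𝓢(Conf n, ℂ) →L[ℂ] 𝓢(Conf n, ℂ) :=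
  Sum.elim (fun j => positionOp (EuclideanSpace.proj j : Conf n →L[ℝ] ℝ))
    (fun j => momentumOp (EuclideanSpace.single j 1))

theorem momentumOp_positionOp {E : Type} [NormedAddCommGroup E] [NormedSpace ℝ E] (l : E →L[ℝ] ℝ)
    (v : E) (f : 𝓢(E, ℂ)) :
    positionOp l (momentumOp v f) - momentumOp v (positionOp l f) = (Complex.I * l v) • f := by
  ext x
  have e : (positionOp l f : E → ℂ) = fun y => (l y : ℂ) * f y := by
    ext y
    exact positionOp_apply l f y
  have h1 : HasFDerivAt (fun y => (l y : ℂ)) (Complex.ofRealCLM ∘L l) x :=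
    (Complex.ofRealCLM ∘L l).hasFDerivAt
  have h := h1.mul (f.hasFDerivAt x)
  simp only [sub_apply, smul_apply, positionOp_apply, momentumOp_apply, e]
  rw [show fderiv ℝ (fun y => (l y : ℂ) * f y) x = _ from h.fderiv]
  simp
  ring

theorem canonicalOp_ccr (n : ℕ) (a b : PhaseIdx n) (f : 𝓢(Conf n, ℂ)) :
    canonicalOp n a (canonicalOp n b f) - canonicalOp n b (canonicalOp n a f) =
      (Complex.I * symplJ n a b) • f := by
  rcases a with j | j <;> rcases b with k | k
  · ext x
    simp [canonicalOp, symplJ, positionOp_apply]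
    ring
  · simp only [canonicalOp, Sum.elim_inl, Sum.elim_inr, momentumOp_positionOp]
    simp [symplJ, Matrix.one_apply]
  · rw [← neg_sub]
    simp only [canonicalOp, Sum.elim_inl, Sum.elim_inr, momentumOp_positionOp]
    simp [symplJ, Matrix.one_apply, eq_comm]
  · simp only [canonicalOp, Sum.elim_inr, symplJ, Matrix.fromBlocks_apply₂₂, Matrix.zero_apply,
      Complex.ofReal_zero, mul_zero, zero_smul, momentumOp, smul_apply,
      map_smul, LineDeriv.lineDerivOpCLM_apply]
    rw [← smul_sub, ← smul_sub]
    ext x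
    have hs : IsSymmSndFDerivAt ℝ f x :=
      (f.smooth 2).contDiffAt.isSymmSndFDerivAt (by simp)
    have e : ∀ (u v : Conf n), fderiv ℝ (∂_{u} f : 𝓢(Conf n, ℂ)) x v =
        fderiv ℝ (fderiv ℝ f) x v u := by
      intro u v
      have : ((∂_{u} f : 𝓢(Conf n, ℂ)) : Conf n → ℂ) = fun y => fderiv ℝ f y u := rfl
      have hd : DifferentiableAt ℝ (fderiv ℝ f) x :=
        (SchwartzMap.fderivCLM ℂ (Conf n) ℂ f).differentiableAt
      rw [this, fderiv_clm_apply hd (differentiableAt_const u)]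
      simp
    simp only [smul_apply, sub_apply,
      SchwartzMap.lineDerivOp_apply_eq_fderiv, e, zero_apply]
    rw [hs.eq, sub_self, smul_zero, smul_zero]

/-! ### The total Hamiltonian on product vectors -/

section ProductHamiltonian

theorem weylQuadratic_sumElim_fromBlocks {E : Type} [NormedAddCommGroup E] [NormedSpace ℝ E]
    {κ ι : Type} [Fintype κ] [Fintype ι] (Q : κ → 𝓢(E, ℂ) →L[ℂ] 𝓢(E, ℂ))
    (P : ι → 𝓢(E, ℂ) →L[ℂ] 𝓢(E, ℂ)) (A : Matrix κ κ ℝ) (B : Matrix κ ι ℝ) (C : Matrix ι κ ℝ)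
    (D : Matrix ι ι ℝ) :
    weylQuadratic (Sum.elim Q P) (Matrix.fromBlocks A B C D) =
      weylQuadratic Q A + weylQuadratic P D +
      (∑ a, ∑ b, ((B a b / 4 : ℝ) : ℂ) • (Q a ∘L P b + P b ∘L Q a) +
        ∑ b, ∑ a, ((C b a / 4 : ℝ) : ℂ) • (P b ∘L Q a + Q a ∘L P b)) := by
  simp only [weylQuadratic, Fintype.sum_sum_type, Sum.elim_inl, Sum.elim_inr,
    Matrix.fromBlocks_apply₁₁, Matrix.fromBlocks_apply₁₂, Matrix.fromBlocks_apply₂₁,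
    Matrix.fromBlocks_apply₂₂, Finset.sum_add_distrib]
  abel

variable {d N : ℕ}

theorem systemOp_schwartzTensor (a : PhaseIdx d) (f : 𝓢(Conf d, ℂ)) (g : 𝓢(Conf N, ℂ)) :
    systemOp d N a (schwartzTensor f g) = schwartzTensor (canonicalOp d a f) g := by
  ext p
  rcases a with j | j
  · simp [systemOp, canonicalOp, positionOp_apply, mul_assoc]
  · simp only [systemOp, canonicalOp, Sum.elim_inr, momentumOp_apply, schwartzTensor_apply]
    have h : HasFDerivAt (schwartzTensor f g : Conf d × Conf N → ℂ) _ p :=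
      ((f.hasFDerivAt p.1).comp p hasFDerivAt_fst).mul
        ((g.hasFDerivAt p.2).comp p hasFDerivAt_snd)
    rw [h.fderiv]
    simp
    ring

theorem environmentOp_schwartzTensor (b : PhaseIdx N) (f : 𝓢(Conf d, ℂ)) (g : 𝓢(Conf N, ℂ)) :
    environmentOp d N b (schwartzTensor f g) = schwartzTensor f (canonicalOp N b g) := by
  ext p
  rcases b with j | j
  · simp [environmentOp, canonicalOp, positionOp_apply, mul_left_comm]
  · simp only [environmentOp, canonicalOp, Sum.elim_inr, momentumOp_apply, schwartzTensor_apply]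
    have h : HasFDerivAt (schwartzTensor f g : Conf d × Conf N → ℂ) _ p :=
      ((f.hasFDerivAt p.1).comp p hasFDerivAt_fst).mul
        ((g.hasFDerivAt p.2).comp p hasFDerivAt_snd)
    rw [h.fderiv]
    simp
    ring

theorem totalHamiltonian_schwartzTensor (MS : Matrix (PhaseIdx d) (PhaseIdx d) ℝ)
    (ME : Matrix (PhaseIdx N) (PhaseIdx N) ℝ) (G : Matrix (PhaseIdx d) (PhaseIdx N) ℝ)
    (f : 𝓢(Conf d, ℂ)) (g : 𝓢(Conf N, ℂ)) :
    totalHamiltonian MS ME G (schwartzTensor f g) =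
      schwartzTensor (weylQuadratic (canonicalOp d) MS f) g +
      schwartzTensor f (weylQuadratic (canonicalOp N) ME g) +
      ∑ a, ∑ b, (G a b : ℂ) • schwartzTensor (canonicalOp d a f) (canonicalOp N b g) := by
  have hS : schwartzTensor (weylQuadratic (canonicalOp d) MS f) g = ∑ a, ∑ b,
      ((MS a b / 4 : ℝ) : ℂ) • (schwartzTensor (canonicalOp d a (canonicalOp d b f)) g +
        schwartzTensor (canonicalOp d b (canonicalOp d a f)) g) := by
    simp only [← schwartzTensorₗ_apply, weylQuadratic, sum_apply,
      smul_apply, add_apply,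
      ContinuousLinearMap.comp_apply, map_sum, map_smul, map_add, LinearMap.sum_apply,
      LinearMap.smul_apply, LinearMap.add_apply]
  have hE : schwartzTensor f (weylQuadratic (canonicalOp N) ME g) = ∑ a, ∑ b,
      ((ME a b / 4 : ℝ) : ℂ) • (schwartzTensor f (canonicalOp N a (canonicalOp N b g)) +
        schwartzTensor f (canonicalOp N b (canonicalOp N a g))) := by
    simp only [← schwartzTensorₗ_apply, weylQuadratic, sum_apply,
      smul_apply, add_apply,
      ContinuousLinearMap.comp_apply, map_sum, map_smul, map_add]
  rw [hS, hE, totalHamiltonian, weylQuadratic_sumElim_fromBlocks]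
  simp only [weylQuadratic, sum_apply, smul_apply, add_apply, ContinuousLinearMap.comp_apply,
    Matrix.transpose_apply, systemOp_schwartzTensor, environmentOp_schwartzTensor]
  -- System and environment coordinates commute on product vectors, so the blocks `G` and `Gᵀ`, each
  -- with two orderings, give four equal contributions of weight 1/4.
  have hG : ∑ a, ∑ b, (G a b : ℂ) • schwartzTensor (canonicalOp d a f) (canonicalOp N b g) =
      ∑ a, ∑ b, ((G a b / 4 : ℝ) : ℂ) •
        (schwartzTensor (canonicalOp d a f) (canonicalOp N b g) +
          schwartzTensor (canonicalOp d a f) (canonicalOp N b g)) +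
      ∑ a, ∑ b, ((G a b / 4 : ℝ) : ℂ) •
        (schwartzTensor (canonicalOp d a f) (canonicalOp N b g) +
          schwartzTensor (canonicalOp d a f) (canonicalOp N b g)) := by
    simp only [← Finset.sum_add_distrib]
    refine Finset.sum_congr rfl fun a _ => Finset.sum_congr rfl fun b _ => ?_
    rw [← smul_add, ← two_smul ℂ (schwartzTensor _ _), ← two_smul ℂ ((2 : ℂ) • _), smul_smul,
      smul_smul]
    congr 1
    push_cast
    ring
  rw [hG, Finset.sum_comm (s := (Finset.univ : Finset (PhaseIdx N)))
    (t := (Finset.univ : Finset (PhaseIdx d)))]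

/-- Supplies the Lipschitz constant for the evolved test vectors. For fixed `φ` the vector is a
combination of fixed Schwartz functions with coefficients continuous in `t`, hence bounded on a
compact interval. -/
theorem exists_norm_totalHamiltonian_le {MS : ℝ → Matrix (PhaseIdx d) (PhaseIdx d) ℝ}
    (hMS : Continuous MS) {ME : ℝ → Matrix (PhaseIdx N) (PhaseIdx N) ℝ} (hME : Continuous ME)
    {G : ℝ → Matrix (PhaseIdx d) (PhaseIdx N) ℝ} (hG : Continuous G)
    (φ : 𝓢(Conf d × Conf N, ℂ)) :
    ∃ C, ∀ t ∈ Set.Icc (-1 : ℝ) 1, ‖(totalHamiltonian (MS t) (ME t) (G t) φ).toLp 2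
      (volume : Measure (Conf d × Conf N))‖ ≤ C := by
  have hM : Continuous fun t => Matrix.fromBlocks (MS t) (G t) (G t)ᵀ (ME t) :=
    hMS.matrix_fromBlocks hG hG.matrix_transpose hME
  have hc : Continuous fun t => totalHamiltonian (MS t) (ME t) (G t) φ := by
    simp only [totalHamiltonian, weylQuadratic, sum_apply,
      smul_apply]
    refine continuous_finsetSum _ fun a _ => continuous_finsetSum _ fun b _ => ?_
    have hab := Complex.continuous_ofReal.comp ((hM.matrix_elem a b).div_const 4)
    exact hab.smul continuous_const
  have hc' : Continuous fun t => (totalHamiltonian (MS t) (ME t) (G t) φ).toLp 2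
      (volume : Measure (Conf d × Conf N)) := SchwartzMap.continuous_toLp.comp hc
  exact isCompact_Icc.exists_bound_of_continuousOn hc'.continuousOn

theorem toLp_schwartzTensor (f : 𝓢(Conf d, ℂ)) (g : 𝓢(Conf N, ℂ)) :
    (schwartzTensor f g).toLp 2 (volume : Measure (Conf d × Conf N)) =
      tensorVec (f.toLp 2) (g.toLp 2) := by
  apply Lp.ext
  filter_upwards [coeFn_tensorVec (f.toLp 2 (volume : Measure (Conf d)))
      (g.toLp 2 (volume : Measure (Conf N))), (schwartzTensor f g).coeFn_toLp 2
      (volume : Measure (Conf d × Conf N)), ae_fst (Y := Conf N) (f.coeFn_toLp 2 (volume : Measure (Conf d))),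
    ae_snd (X := Conf d) (g.coeFn_toLp 2 (volume : Measure (Conf N)))] with p h1 h2 h3 h4
  rw [h1, h2, h3, h4, schwartzTensor_apply]

theorem inner_tensorVec (f f' : L2 (Conf d)) (g g' : L2 (Conf N)) :
    ⟪tensorVec f g, tensorVec f' g'⟫_ℂ = ⟪f, f'⟫_ℂ * ⟪g, g'⟫_ℂ := by
  rw [L2.inner_def, L2.inner_def, L2.inner_def, ← integral_prod_mul]
  refine integral_congr_ae ?_
  filter_upwards [coeFn_tensorVec f g, coeFn_tensorVec f' g'] with p h1 h2
  rw [h1, h2]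
  simp only [RCLike.inner_apply, map_mul]
  ring

end ProductHamiltonian

/-! ### Integrability and integration by parts for the Weyl kernel -/

section WeylKernel

theorem Matrix.PosDef.exists_pos_mul_sum_sq_le {κ : Type*} [Fintype κ] {A : Matrix κ κ ℝ}
    (hA : A.PosDef) : ∃ c > 0, ∀ x : κ → ℝ, c * ∑ a, x a ^ 2 ≤ x ⬝ᵥ (A *ᵥ x) := by
  classical
  have hpos : ∀ x : κ → ℝ, x ≠ 0 → 0 < x ⬝ᵥ (A *ᵥ x) := fun x hx => by
    simpa using hA.dotProduct_mulVec_pos hx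
  have hcont : Continuous fun x : EuclideanSpace ℝ κ => x.ofLp ⬝ᵥ (A *ᵥ x.ofLp) := by
    fun_prop
  rcases isEmpty_or_nonempty κ with hκ | hκ
  · exact ⟨1, one_pos, fun x => by simp [dotProduct]⟩
  obtain ⟨x₀, hx₀, hmin⟩ := (isCompact_sphere (0 : EuclideanSpace ℝ κ) 1).exists_isMinOn
    (NormedSpace.sphere_nonempty.2 zero_le_one) hcont.continuousOn
  have hx₀' : x₀.ofLp ≠ 0 := by
    intro h
    have : x₀ = 0 := by ext a; simp [h]
    simp [this] at hx₀
  refine ⟨_, hpos _ hx₀', fun x => ?_⟩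
  set y : EuclideanSpace ℝ κ := WithLp.toLp 2 x with hy
  have hn : ‖y‖ ^ 2 = ∑ a, x a ^ 2 := by simp [EuclideanSpace.norm_sq_eq, hy]
  rcases eq_or_ne y 0 with h0 | h0
  · have : x = 0 := by
      have := congrArg WithLp.ofLp h0
      simpa [hy] using this
    simp [this]
  · have hyn : ‖y‖ ≠ 0 := norm_ne_zero_iff.2 h0
    have hmem : ‖y‖⁻¹ • y ∈ Metric.sphere (0 : EuclideanSpace ℝ κ) 1 := by
      simp [norm_smul, hyn]
    have h1 := hmin hmem
    simp only [Set.mem_ofPred_eq, WithLp.ofLp_smul, Matrix.mulVec_smul, smul_dotProduct,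
      dotProduct_smul, smul_eq_mul] at h1
    rw [← hn]
    calc _ ≤ (‖y‖⁻¹ * (‖y‖⁻¹ * (y.ofLp ⬝ᵥ (A *ᵥ y.ofLp)))) * ‖y‖ ^ 2 := by gcongr
      _ = _ := by field_simp; rfl

variable {n : ℕ}

theorem exists_gaussianSymbol_le {Γ : Matrix (PhaseIdx n) (PhaseIdx n) ℝ} (hΓ : Γ.PosDef)
    (m : PhaseIdx n → ℝ) : ∃ C c : ℝ, 0 ≤ C ∧ 0 < c ∧ ∀ z, (1 + ∑ a, (z a - m a) ^ 2) *
      ‖gaussianSymbol Γ m z‖ ≤ C * Real.exp (-c * ∑ a, (z a - m a) ^ 2) := by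
  obtain ⟨c, hc, h⟩ := hΓ.inv.exists_pos_mul_sum_sq_le
  set B := (Real.sqrt Γ.det)⁻¹
  have hB : 0 ≤ B := by positivity
  refine ⟨(1 + 4 / c) * B, c / 4, by positivity, by positivity, fun z => ?_⟩
  have hz := h (z - m)
  simp only [Pi.sub_apply] at hz
  set S := ∑ a, (z a - m a) ^ 2
  have hS : 0 ≤ S := Finset.sum_nonneg fun a _ => sq_nonneg _
  -- The exponent available is `c/2`; half of it absorbs the polynomial factor and `c/4` remains.
  have h1 : 1 + S ≤ (1 + 4 / c) * Real.exp (c / 4 * S) := by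
    have e1 := Real.add_one_le_exp (c / 4 * S)
    have e2 : 1 ≤ Real.exp (c / 4 * S) := Real.one_le_exp (by positivity)
    have e3 : S = 4 / c * (c / 4 * S) := by field_simp
    have e4 : S ≤ 4 / c * Real.exp (c / 4 * S) := by
      conv_lhs => rw [e3]
      gcongr
      linarith
    linarith
  rw [gaussianSymbol, Real.norm_of_nonneg (by positivity)]
  calc (1 + S) * (B * Real.exp (-(1 / 2) * ((z - m) ⬝ᵥ Γ⁻¹ *ᵥ (z - m))))
      ≤ ((1 + 4 / c) * Real.exp (c / 4 * S)) * (B * Real.exp (-(1 / 2) * (c * S))) := by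
        gcongr ?_ * (B * Real.exp ?_)
        linarith
    _ = (1 + 4 / c) * B * (Real.exp (c / 4 * S) * Real.exp (-(1 / 2) * (c * S))) := by ring
    _ = (1 + 4 / c) * B * Real.exp (-(c / 4) * S) := by
        rw [← Real.exp_add]
        ring_nf

/-- The phase space point `((x + y) / 2, ξ)` for `p = (x, y, ξ)`. -/
noncomputable def weylPoint (p : Conf n × (Conf n × Conf n)) : PhaseIdx n → ℝ :=
  Sum.elim (fun j => (p.1 j + p.2.1 j) / 2) (fun j => p.2.2 j)

/-- The oscillating factor `exp (i (x - y) ⬝ ξ)` times the Gaussian symbol at `((x + y) / 2, ξ)`. -/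
noncomputable def weylKernel (Γ : Matrix (PhaseIdx n) (PhaseIdx n) ℝ) (m : PhaseIdx n → ℝ)
    (p : Conf n × (Conf n × Conf n)) : ℂ :=
  Complex.exp (Complex.I * ((inner ℝ (p.1 - p.2.1) p.2.2 : ℝ) : ℂ)) *
    (gaussianSymbol Γ m (weylPoint p) : ℂ)

theorem continuous_weylPoint : Continuous (weylPoint (n := n)) := by
  refine continuous_pi fun a => ?_
  rcases a with j | j <;> simp only [weylPoint, Sum.elim_inl, Sum.elim_inr] <;> fun_prop

theorem continuous_weylKernel (Γ : Matrix (PhaseIdx n) (PhaseIdx n) ℝ) (m : PhaseIdx n → ℝ) :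
    Continuous (weylKernel Γ m) := by
  have h1 := continuous_weylPoint (n := n)
  have h2 : Continuous (gaussianSymbol Γ m) := by
    unfold gaussianSymbol
    fun_prop
  unfold weylKernel
  have h3 := Complex.continuous_ofReal.comp (h2.comp h1)
  refine Continuous.mul ?_ h3
  fun_prop

theorem norm_weylKernel (Γ : Matrix (PhaseIdx n) (PhaseIdx n) ℝ) (m : PhaseIdx n → ℝ)
    (p : Conf n × (Conf n × Conf n)) :
    ‖weylKernel Γ m p‖ = ‖gaussianSymbol Γ m (weylPoint p)‖ := by
  rw [weylKernel, norm_mul, mul_comm Complex.I, Complex.norm_exp_ofReal_mul_I, one_mul,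
    Complex.norm_real]

/-- The test functions give decay in `x` and `y`, so Gaussian decay is needed in the momentum `ξ`
only. -/
theorem integrable_schwartz_mul_of_gaussian_bound (ψ φ : 𝓢(Conf n, ℂ))
    {h : Conf n × (Conf n × Conf n) → ℂ} (hc : Continuous h) {C c : ℝ} (hc0 : 0 < c) (w : Conf n)
    (hb : ∀ p, ‖h p‖ ≤ C * Real.exp (-c * ‖p.2.2 - w‖ ^ 2)) :
    Integrable (fun p => star (ψ p.1) * φ p.2.1 * h p) := by
  have hg : Integrable (fun v : Conf n => Real.exp (-c * ‖v‖ ^ 2)) := by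
    have := (GaussianFourier.integrable_cexp_neg_mul_sq_norm_add (V := Conf n) (b := c)
      (by simpa using hc0) 0 0).norm
    refine this.congr (Filter.Eventually.of_forall fun v => ?_)
    simp only [zero_mul, add_zero, Complex.norm_exp]
    norm_cast
  have hg' : Integrable (fun v : Conf n => C * Real.exp (-c * ‖v - w‖ ^ 2)) :=
    (hg.comp_sub_right w).const_mul C
  have hi := (ψ.integrable (μ := volume)).norm.mul_prod
    ((φ.integrable (μ := volume)).norm.mul_prod hg')
  refine hi.mono' ?_ (Filter.Eventually.of_forall fun p => ?_)
  · refine Continuous.aestronglyMeasurable ?_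
    have := ψ.continuous
    have := φ.continuous
    fun_prop
  · rw [norm_mul, norm_mul, norm_star, mul_assoc]
    have := hb p
    gcongr

theorem sum_sq_weylPoint_ge (m : PhaseIdx n → ℝ) (p : Conf n × (Conf n × Conf n)) :
    ‖p.2.2 - WithLp.toLp 2 (fun j => m (Sum.inr j))‖ ^ 2 ≤ ∑ a, (weylPoint p a - m a) ^ 2 := by
  rw [EuclideanSpace.norm_sq_eq, Fintype.sum_sum_type]
  have : 0 ≤ ∑ j, (weylPoint p (Sum.inl j) - m (Sum.inl j)) ^ 2 :=
    Finset.sum_nonneg fun _ _ => sq_nonneg _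
  refine (le_add_of_nonneg_left this).trans' (le_of_eq ?_)
  simp [weylPoint]

variable {Γ : Matrix (PhaseIdx n) (PhaseIdx n) ℝ} {m : PhaseIdx n → ℝ}

theorem integrable_weylKernel_mul (hΓ : Γ.PosDef) (ψ φ : 𝓢(Conf n, ℂ))
    {h : Conf n × (Conf n × Conf n) → ℂ} (hc : Continuous h)
    (hh : ∀ p, ‖h p‖ ≤ 1 + ∑ a, (weylPoint p a - m a) ^ 2) :
    Integrable (fun p => star (ψ p.1) * φ p.2.1 * (weylKernel Γ m p * h p)) := by
  obtain ⟨C, c, hC, hc0, hb⟩ := exists_gaussianSymbol_le hΓ m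
  refine integrable_schwartz_mul_of_gaussian_bound ψ φ ((continuous_weylKernel Γ m).mul hc) hc0
    (C := C) (WithLp.toLp 2 fun j => m (Sum.inr j)) fun p => ?_
  rw [norm_mul, norm_weylKernel, mul_comm]
  have h1 := sum_sq_weylPoint_ge m p
  calc _ ≤ (1 + ∑ a, (weylPoint p a - m a) ^ 2) * ‖gaussianSymbol Γ m (weylPoint p)‖ := by
        gcongr
        exact hh p
    _ ≤ _ := hb _
    _ ≤ _ := by
        gcongr ?_ * Real.exp ?_
        nlinarith

theorem integrable_weylKernel (hΓ : Γ.PosDef) (ψ φ : 𝓢(Conf n, ℂ)) :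
    Integrable (fun p => star (ψ p.1) * φ p.2.1 * weylKernel Γ m p) := by
  have := integrable_weylKernel_mul (m := m) hΓ ψ φ (h := fun _ => 1) continuous_const (fun p => by
    have : 0 ≤ ∑ a, (weylPoint p a - m a) ^ 2 := Finset.sum_nonneg fun _ _ => sq_nonneg _
    simpa using this)
  simpa only [mul_one] using this

theorem integrable_weylKernel_coord (hΓ : Γ.PosDef) (ψ φ : 𝓢(Conf n, ℂ)) (b : PhaseIdx n) :
    Integrable (fun p => star (ψ p.1) * φ p.2.1 *
      (weylKernel Γ m p * ((weylPoint p b - m b : ℝ) : ℂ))) := by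
  refine integrable_weylKernel_mul hΓ ψ φ ?_ fun p => ?_
  · exact Complex.continuous_ofReal.comp
      (((continuous_apply b).comp continuous_weylPoint).sub continuous_const)
  · rw [Complex.norm_real, Real.norm_eq_abs]
    have h1 : (weylPoint p b - m b) ^ 2 ≤ ∑ a, (weylPoint p a - m a) ^ 2 :=
      Finset.single_le_sum (f := fun a => (weylPoint p a - m a) ^ 2) (fun _ _ => sq_nonneg _)
        (Finset.mem_univ b)
    refine le_trans ?_ (add_le_add_right h1 1)
    rcases abs_cases (weylPoint p b - m b) with h | h <;>
      nlinarith [sq_nonneg (weylPoint p b - m b - 1), sq_nonneg (weylPoint p b - m b + 1)]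

theorem weylPoint_add_smul (p v : Conf n × (Conf n × Conf n)) (t : ℝ) :
    weylPoint (p + t • v) - m = (weylPoint p - m) + t • weylPoint v := by
  ext a
  rcases a with j | j <;> simp [weylPoint] <;> ring

/-- Along a line both the phase and the Gaussian exponent are quadratic polynomials in `t`; the
derivative reads off their linear coefficients, the symmetry of `Γ⁻¹` merging the two cross terms.
-/
theorem hasLineDerivAt_weylKernel (hΓ : Γ.PosDef) (p v : Conf n × (Conf n × Conf n)) :
    HasLineDerivAt ℝ (weylKernel Γ m)
      ((Complex.I * ((inner ℝ (v.1 - v.2.1) p.2.2 + inner ℝ (p.1 - p.2.1) v.2.2 : ℝ) : ℂ) -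
        ((weylPoint v ⬝ᵥ (Γ⁻¹ *ᵥ (weylPoint p - m)) : ℝ) : ℂ)) * weylKernel Γ m p) p v := by
  set q0 := (weylPoint p - m) ⬝ᵥ (Γ⁻¹ *ᵥ (weylPoint p - m)) with hq0
  set q1 := weylPoint v ⬝ᵥ (Γ⁻¹ *ᵥ (weylPoint p - m)) with hq1
  set q2 := weylPoint v ⬝ᵥ (Γ⁻¹ *ᵥ weylPoint v)
  set i0 : ℝ := inner ℝ (p.1 - p.2.1) p.2.2 with hi0
  set i1 : ℝ := inner ℝ (v.1 - v.2.1) p.2.2 + inner ℝ (p.1 - p.2.1) v.2.2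
  set i2 : ℝ := inner ℝ (v.1 - v.2.1) v.2.2
  have hsymm : (weylPoint p - m) ⬝ᵥ (Γ⁻¹ *ᵥ weylPoint v) = q1 := by
    have ht : (Γ⁻¹)ᵀ = Γ⁻¹ := by
      have := hΓ.inv.isHermitian.eq
      rwa [Matrix.conjTranspose_eq_transpose_of_trivial] at this
    rw [Matrix.dotProduct_mulVec, ← Matrix.mulVec_transpose, ht, dotProduct_comm]
  have hk : ∀ t : ℝ, weylKernel Γ m (p + t • v) =
      Complex.exp (Complex.I * ((i0 + t * i1 + t ^ 2 * i2 : ℝ) : ℂ)) *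
        (((Real.sqrt Γ.det)⁻¹ * Real.exp (-(1 / 2) * (q0 + t * (2 * q1) + t ^ 2 * q2)) : ℝ) : ℂ) := by
    intro t
    have e1 : (inner ℝ ((p + t • v).1 - (p + t • v).2.1) (p + t • v).2.2 : ℝ) =
        i0 + t * i1 + t ^ 2 * i2 := by
      have : (p + t • v).1 - (p + t • v).2.1 = (p.1 - p.2.1) + t • (v.1 - v.2.1) := by
        simp only [Prod.fst_add, Prod.snd_add, Prod.smul_fst, Prod.smul_snd, smul_sub]
        abel
      rw [this]
      simp only [Prod.snd_add, Prod.smul_snd, inner_add_left, inner_add_right,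
        real_inner_smul_left, real_inner_smul_right, i0, i1, i2]
      ring
    have e2 : (weylPoint (p + t • v) - m) ⬝ᵥ (Γ⁻¹ *ᵥ (weylPoint (p + t • v) - m)) =
        q0 + t * (2 * q1) + t ^ 2 * q2 := by
      rw [weylPoint_add_smul, Matrix.mulVec_add, Matrix.mulVec_smul, add_dotProduct,
        dotProduct_add, dotProduct_add, dotProduct_smul, smul_dotProduct, smul_dotProduct,
        dotProduct_smul, hsymm, ← hq0, ← hq1]
      simp only [smul_eq_mul, q2]
      ring
    rw [weylKernel, gaussianSymbol, e1, e2]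
  have h1 : HasDerivAt (fun t : ℝ => i0 + t * i1 + t ^ 2 * i2) i1 0 := by
    have := (((hasDerivAt_id (0 : ℝ)).mul_const i1).const_add i0).add
      (((hasDerivAt_id (0 : ℝ)).pow 2).mul_const i2)
    convert! this using 1
    simp
  have h2 : HasDerivAt (fun t : ℝ => q0 + t * (2 * q1) + t ^ 2 * q2) (2 * q1) 0 := by
    have := (((hasDerivAt_id (0 : ℝ)).mul_const (2 * q1)).const_add q0).add
      (((hasDerivAt_id (0 : ℝ)).pow 2).mul_const q2)
    convert! this using 1
    simp
  have h3 := (h1.ofReal_comp.const_mul Complex.I).cexp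
  have h4 := (((h2.const_mul (-(1 / 2))).exp).const_mul (Real.sqrt Γ.det)⁻¹).ofReal_comp
  have h5 := h3.mul h4
  unfold HasLineDerivAt
  simp only [hk]
  convert! h5 using 1
  have hp := hk 0
  simp only [zero_smul, add_zero, zero_mul, ne_eq, OfNat.ofNat_ne_zero, not_false_eq_true,
    zero_pow] at hp ⊢
  rw [hp]
  push_cast
  ring

theorem hasLineDerivAt_schwartz_mul (ψ φ : 𝓢(Conf n, ℂ)) (p v : Conf n × (Conf n × Conf n)) :
    HasLineDerivAt ℝ (fun p : Conf n × (Conf n × Conf n) => star (ψ p.1) * φ p.2.1)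
      (star (fderiv ℝ ψ p.1 v.1) * φ p.2.1 + star (ψ p.1) * fderiv ℝ φ p.2.1 v.2.1) p v := by
  have h1 : HasFDerivAt (fun p : Conf n × (Conf n × Conf n) => star (ψ p.1)) _ p :=
    ((ψ.hasFDerivAt p.1).comp p hasFDerivAt_fst).star
  have h2 : HasFDerivAt (fun p : Conf n × (Conf n × Conf n) => φ p.2.1) _ p :=
    (φ.hasFDerivAt p.2.1).comp p (hasFDerivAt_fst.comp p hasFDerivAt_snd)
  have h := (h1.mul h2).hasLineDerivAt v
  convert! h using 1
  simp
  ring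

instance isAddHaarMeasure_volume_triple :
    (volume : Measure (Conf n × (Conf n × Conf n))).IsAddHaarMeasure := by
  have h : ((volume : Measure (Conf n)).prod (volume : Measure (Conf n))).IsAddHaarMeasure :=
    inferInstance
  have h' : (volume : Measure (Conf n × Conf n)).IsAddHaarMeasure := h
  exact Measure.prod.instIsAddHaarMeasure (volume : Measure (Conf n))
    (volume : Measure (Conf n × Conf n))

/-- Integration by parts against the Weyl kernel. -/
theorem integral_mul_weylKernel_lineDeriv (hΓ : Γ.PosDef) (ψ φ : 𝓢(Conf n, ℂ))
    (v : Conf n × (Conf n × Conf n)) {k' : Conf n × (Conf n × Conf n) → ℂ}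
    (hk' : ∀ p, (Complex.I * ((inner ℝ (v.1 - v.2.1) p.2.2 +
      inner ℝ (p.1 - p.2.1) v.2.2 : ℝ) : ℂ) -
        ((weylPoint v ⬝ᵥ (Γ⁻¹ *ᵥ (weylPoint p - m)) : ℝ) : ℂ)) * weylKernel Γ m p = k' p)
    (hi : Integrable fun p => star (ψ p.1) * φ p.2.1 * k' p) :
    ∫ p, star (ψ p.1) * φ p.2.1 * k' p =
      -((∫ p, star ((∂_{v.1} ψ : 𝓢(Conf n, ℂ)) p.1) * φ p.2.1 * weylKernel Γ m p) +
        ∫ p, star (ψ p.1) * (∂_{v.2.1} φ : 𝓢(Conf n, ℂ)) p.2.1 * weylKernel Γ m p) := by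
  have i1 := integrable_weylKernel (m := m) hΓ (∂_{v.1} ψ : 𝓢(Conf n, ℂ)) φ
  have i2 := integrable_weylKernel (m := m) hΓ ψ (∂_{v.2.1} φ : 𝓢(Conf n, ℂ))
  have hs : ∀ p : Conf n × (Conf n × Conf n),
      (star (fderiv ℝ ψ p.1 v.1) * φ p.2.1 + star (ψ p.1) * fderiv ℝ φ p.2.1 v.2.1) *
        weylKernel Γ m p = star ((∂_{v.1} ψ : 𝓢(Conf n, ℂ)) p.1) * φ p.2.1 * weylKernel Γ m p +
        star (ψ p.1) * (∂_{v.2.1} φ : 𝓢(Conf n, ℂ)) p.2.1 * weylKernel Γ m p := fun p => by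
    rw [SchwartzMap.lineDerivOp_apply_eq_fderiv, SchwartzMap.lineDerivOp_apply_eq_fderiv, add_mul]
  have h := integral_bilinear_hasLineDerivAt_right_eq_neg_left_of_integrable
    (μ := (volume : Measure (Conf n × (Conf n × Conf n)))) (B := ContinuousLinearMap.mul ℝ ℂ)
    (f := fun p => star (ψ p.1) * φ p.2.1)
    (f' := fun p => star (fderiv ℝ ψ p.1 v.1) * φ p.2.1 + star (ψ p.1) * fderiv ℝ φ p.2.1 v.2.1)
    (g := weylKernel Γ m) (g' := k') (v := v)
    (by
      simp only [ContinuousLinearMap.mul_apply', hs]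
      exact i1.add i2)
    hi (integrable_weylKernel hΓ ψ φ)
    (fun p _ => hasLineDerivAt_schwartz_mul ψ φ p v)
    (fun p _ => by rw [← hk']; exact hasLineDerivAt_weylKernel hΓ p v)
  simp only [ContinuousLinearMap.mul_apply', hs] at h
  rw [h, integral_add i1 i2]

end WeylKernel

/-! ### Gaussian states satisfy the Gaussian commutator relations -/

section GaussianState

variable {n : ℕ}

/-- The matrix elements of a bounded operator between Schwartz functions. -/
noncomputable def stateForm (ρ : L2 (Conf n) →L[ℂ] L2 (Conf n)) :
    𝓢(Conf n, ℂ) →ₗ⋆[ℂ] 𝓢(Conf n, ℂ) →ₗ[ℂ] ℂ :=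
  LinearMap.mk₂'ₛₗ (starRingEnd ℂ) (RingHom.id ℂ)
    (fun ψ φ => ⟪SchwartzMap.toLpCLM ℂ ℂ 2 (volume : Measure (Conf n)) ψ,
      ρ (SchwartzMap.toLpCLM ℂ ℂ 2 (volume : Measure (Conf n)) φ)⟫_ℂ)
    (fun ψ ψ' φ => by simp only [map_add, inner_add_left])
    (fun c ψ φ => by simp only [map_smul, inner_smul_left, smul_eq_mul])
    (fun ψ φ φ' => by simp only [map_add, inner_add_right])
    (fun c ψ φ => by simp only [map_smul, inner_smul_right, smul_eq_mul, RingHom.id_apply])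

theorem stateForm_apply (ρ : L2 (Conf n) →L[ℂ] L2 (Conf n)) (ψ φ : 𝓢(Conf n, ℂ)) :
    stateForm ρ ψ φ = ⟪ψ.toLp 2 (volume : Measure (Conf n)), ρ (φ.toLp 2)⟫_ℂ := rfl

/-- Schwartz functions are dense in `L²`, so a bounded operator is determined by its matrix elements
between them. -/
theorem exists_stateForm_ne_zero {ρ : L2 (Conf n) →L[ℂ] L2 (Conf n)} (hρ : ρ ≠ 0) :
    ∃ ψ φ, stateForm ρ ψ φ ≠ 0 := by
  by_contra! h
  have hd : DenseRange (SchwartzMap.toLpCLM ℂ ℂ 2 (volume : Measure (Conf n))) := by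
    exact SchwartzMap.denseRange_toLpCLM (by simp)
  apply hρ
  have h1 : ∀ φ : 𝓢(Conf n, ℂ), ρ (SchwartzMap.toLpCLM ℂ ℂ 2 (volume : Measure (Conf n)) φ) = 0 := by
    intro φ
    have h2 : ∀ x : L2 (Conf n),
        ⟪x, ρ (SchwartzMap.toLpCLM ℂ ℂ 2 (volume : Measure (Conf n)) φ)⟫_ℂ = 0 := fun x =>
      hd.induction_on x (isClosed_eq (by fun_prop) continuous_const) fun ψ => h ψ φ
    exact inner_self_eq_zero.1 (h2 _)
  ext1 x
  exact hd.induction_on x (isClosed_eq (by fun_prop) continuous_const) h1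

variable {Γ : Matrix (PhaseIdx n) (PhaseIdx n) ℝ} {m : PhaseIdx n → ℝ}

theorem stateForm_eq_integral {ρ : L2 (Conf n) →L[ℂ] L2 (Conf n)} (hΓ : Γ.PosDef)
    (hρ : HasWeylSymbol ρ (gaussianSymbol Γ m)) (ψ φ : 𝓢(Conf n, ℂ)) :
    stateForm ρ ψ φ = ((2 * Real.pi : ℝ) : ℂ)⁻¹ ^ n *
      ∫ p : Conf n × (Conf n × Conf n), star (ψ p.1) * φ p.2.1 * weylKernel Γ m p := by
  rw [stateForm_apply, L2.inner_def]
  have h : ∀ᵐ x : Conf n, inner ℂ ((ψ.toLp 2 (volume : Measure (Conf n))) x) (ρ (φ.toLp 2) x) =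
      ((2 * Real.pi : ℝ) : ℂ)⁻¹ ^ n *
        ∫ q : Conf n × Conf n, star (ψ x) * φ q.1 * weylKernel Γ m (x, q) := by
    filter_upwards [hρ φ, ψ.coeFn_toLp 2 (volume : Measure (Conf n))] with x h1 h2
    rw [h1, h2, RCLike.inner_apply, mul_assoc, ← integral_mul_const]
    congr 1
    refine integral_congr_ae (Filter.Eventually.of_forall fun q => ?_)
    simp only [weylKernel, weylPoint, starRingEnd_apply]
    ring
  rw [integral_congr_ae h, integral_const_mul]
  congr 1
  exact (integral_prod (μ := (volume : Measure (Conf n)))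
    (ν := (volume : Measure (Conf n × Conf n)))
    (fun p : Conf n × (Conf n × Conf n) => star (ψ p.1) * φ p.2.1 * weylKernel Γ m p)
    (integrable_weylKernel hΓ ψ φ)).symm

theorem canonicalOp_inl_apply (j : Fin n) (φ : 𝓢(Conf n, ℂ)) (x : Conf n) :
    canonicalOp n (Sum.inl j) φ x = (x j : ℂ) * φ x := by
  simp [canonicalOp, positionOp_apply]

theorem canonicalOp_inr_apply (j : Fin n) (φ : 𝓢(Conf n, ℂ)) (x : Conf n) :
    canonicalOp n (Sum.inr j) φ x =
      -Complex.I * (∂_{(EuclideanSpace.single j 1 : Conf n)} φ : 𝓢(Conf n, ℂ)) x := by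
  simp [canonicalOp, momentumOp_apply, SchwartzMap.lineDerivOp_apply_eq_fderiv]

/-- The integral `∫ conj ψ(x) φ(y) k(x, y, ξ)` against the Weyl kernel. -/
noncomputable def weylIntegral (Γ : Matrix (PhaseIdx n) (PhaseIdx n) ℝ) (m : PhaseIdx n → ℝ)
    (ψ φ : 𝓢(Conf n, ℂ)) : ℂ :=
  ∫ p : Conf n × (Conf n × Conf n), star (ψ p.1) * φ p.2.1 * weylKernel Γ m p

/-- The integral of a centred phase space coordinate against the Weyl kernel. -/
noncomputable def weylMoment (Γ : Matrix (PhaseIdx n) (PhaseIdx n) ℝ) (m : PhaseIdx n → ℝ)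
    (b : PhaseIdx n) (ψ φ : 𝓢(Conf n, ℂ)) : ℂ :=
  ∫ p : Conf n × (Conf n × Conf n), star (ψ p.1) * φ p.2.1 *
    (weylKernel Γ m p * ((weylPoint p b - m b : ℝ) : ℂ))

theorem weylIntegral_canonicalOp_inr (j : Fin n) (ψ φ : 𝓢(Conf n, ℂ)) :
    weylIntegral Γ m (canonicalOp n (Sum.inr j) ψ) φ =
        Complex.I * weylIntegral Γ m (∂_{(EuclideanSpace.single j 1 : Conf n)} ψ) φ ∧
      weylIntegral Γ m ψ (canonicalOp n (Sum.inr j) φ) =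
        -Complex.I * weylIntegral Γ m ψ (∂_{(EuclideanSpace.single j 1 : Conf n)} φ) := by
  constructor
  · rw [weylIntegral, weylIntegral, ← integral_const_mul]
    refine integral_congr_ae (Filter.Eventually.of_forall fun p => ?_)
    simp only [canonicalOp_inr_apply, star_mul', star_neg, Complex.star_def, Complex.conj_I]
    ring
  · rw [weylIntegral, weylIntegral, ← integral_const_mul]
    refine integral_congr_ae (Filter.Eventually.of_forall fun p => ?_)
    simp only [canonicalOp_inr_apply]
    ring

/-- Symmetrized multiplication by a canonical coordinate multiplies the Weyl symbol. -/
theorem symMul_weylIntegral (hΓ : Γ.PosDef) (a : PhaseIdx n) (ψ φ : 𝓢(Conf n, ℂ)) :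
    symMul (fun a => (canonicalOp n a : 𝓢(Conf n, ℂ) →ₗ[ℂ] 𝓢(Conf n, ℂ))) m a
      (weylIntegral Γ m) ψ φ = weylMoment Γ m a ψ φ := by
  have h0 := integrable_weylKernel (m := m) hΓ ψ φ
  rcases a with j | j
  · have h1 := integrable_weylKernel (m := m) hΓ (canonicalOp n (Sum.inl j) ψ) φ
    have h2 := integrable_weylKernel (m := m) hΓ ψ (canonicalOp n (Sum.inl j) φ)
    simp only [symMul, ContinuousLinearMap.coe_coe, weylIntegral, weylMoment]
    have h3 : Integrable fun p : Conf n × (Conf n × Conf n) =>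
        (star (canonicalOp n (Sum.inl j) ψ p.1) * φ p.2.1 * weylKernel Γ m p +
          star (ψ p.1) * canonicalOp n (Sum.inl j) φ p.2.1 * weylKernel Γ m p) / 2 :=
      (h1.add h2).div_const 2
    rw [← integral_add h1 h2, ← integral_div, ← integral_const_mul,
      ← integral_sub h3 (h0.const_mul _)]
    refine integral_congr_ae (Filter.Eventually.of_forall fun p => ?_)
    simp only [canonicalOp_inl_apply, star_mul', weylPoint, Sum.elim_inl, Complex.star_def,
      Complex.conj_ofReal]
    push_cast
    ring
  · have hc := integrable_weylKernel_coord (m := m) hΓ ψ φ (Sum.inr j)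
    have hi : Integrable fun p : Conf n × (Conf n × Conf n) => star (ψ p.1) * φ p.2.1 *
        (2 * Complex.I * (weylKernel Γ m p * ((weylPoint p (Sum.inr j) - m (Sum.inr j) : ℝ) : ℂ)) +
          2 * Complex.I * m (Sum.inr j) * weylKernel Γ m p) := by
      refine ((hc.const_mul (2 * Complex.I)).add
        (h0.const_mul (2 * Complex.I * m (Sum.inr j)))).congr
        (Filter.Eventually.of_forall fun p => ?_)
      simp only [Pi.add_apply]
      ring
    -- Moving `x` and `y` oppositely fixes the midpoint and `ξ`, so only the phase varies and its
    -- derivative produces the factor `2 i ξ_j`.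
    have h := integral_mul_weylKernel_lineDeriv (m := m) hΓ ψ φ
      (EuclideanSpace.single j 1, (-EuclideanSpace.single j 1, 0)) (fun p => by
        have hz : weylPoint ((EuclideanSpace.single j 1, (-EuclideanSpace.single j 1, 0)) :
            Conf n × (Conf n × Conf n)) = 0 := by
          ext a
          rcases a with i | i <;> simp [weylPoint]
        have hin : (inner ℝ ((EuclideanSpace.single j 1 : Conf n) - -EuclideanSpace.single j 1) p.2.2
            + inner ℝ (p.1 - p.2.1) (0 : Conf n) : ℝ) = 2 * weylPoint p (Sum.inr j) := by
          rw [inner_zero_right, sub_neg_eq_add, inner_add_left, EuclideanSpace.inner_single_left]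
          simp [weylPoint]
          ring
        rw [hz, hin, zero_dotProduct]
        show _ = 2 * Complex.I *
          (weylKernel Γ m p * ((weylPoint p (Sum.inr j) - m (Sum.inr j) : ℝ) : ℂ)) +
          2 * Complex.I * m (Sum.inr j) * weylKernel Γ m p
        push_cast
        ring) hi
    have hsplit : ∫ p : Conf n × (Conf n × Conf n), star (ψ p.1) * φ p.2.1 *
        (2 * Complex.I * (weylKernel Γ m p * ((weylPoint p (Sum.inr j) - m (Sum.inr j) : ℝ) : ℂ)) +
          2 * Complex.I * m (Sum.inr j) * weylKernel Γ m p) =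
        2 * Complex.I * weylMoment Γ m (Sum.inr j) ψ φ +
          2 * Complex.I * m (Sum.inr j) * weylIntegral Γ m ψ φ := by
      rw [weylMoment, weylIntegral, ← integral_const_mul, ← integral_const_mul,
        ← integral_add (hc.const_mul _) (h0.const_mul _)]
      refine integral_congr_ae (Filter.Eventually.of_forall fun p => ?_)
      simp only
      ring
    obtain ⟨e1, e2⟩ := weylIntegral_canonicalOp_inr (Γ := Γ) (m := m) j ψ φ
    rw [hsplit] at h
    have hneg : ∫ p : Conf n × (Conf n × Conf n), star (ψ p.1) *
        (∂_{(-EuclideanSpace.single j 1 : Conf n)} φ : 𝓢(Conf n, ℂ)) p.2.1 * weylKernel Γ m p =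
        -weylIntegral Γ m ψ (∂_{(EuclideanSpace.single j 1 : Conf n)} φ) := by
      rw [weylIntegral, ← integral_neg]
      refine integral_congr_ae (Filter.Eventually.of_forall fun p => ?_)
      simp [SchwartzMap.lineDerivOp_apply_eq_fderiv]
    simp only at h
    rw [hneg] at h
    change _ = -(weylIntegral Γ m (∂_{(EuclideanSpace.single j 1 : Conf n)} ψ) φ + _) at h
    simp only [symMul, ContinuousLinearMap.coe_coe, e1, e2]
    linear_combination (Complex.I / 2) * h - (weylMoment Γ m (Sum.inr j) ψ φ +
      m (Sum.inr j) * weylIntegral Γ m ψ φ) * Complex.I_mul_I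

theorem integral_weylKernel_mul_mulVec (hΓ : Γ.PosDef) (a : PhaseIdx n) (ψ φ : 𝓢(Conf n, ℂ)) :
    Integrable (fun p : Conf n × (Conf n × Conf n) => star (ψ p.1) * φ p.2.1 *
      (weylKernel Γ m p * (((Γ⁻¹ *ᵥ (weylPoint p - m)) a : ℝ) : ℂ))) ∧
    ∫ p : Conf n × (Conf n × Conf n), star (ψ p.1) * φ p.2.1 *
      (weylKernel Γ m p * (((Γ⁻¹ *ᵥ (weylPoint p - m)) a : ℝ) : ℂ)) =
      ∑ b, (Γ⁻¹ a b : ℂ) * weylMoment Γ m b ψ φ := by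
  have hc := fun b => (integrable_weylKernel_coord (m := m) hΓ ψ φ b).const_mul (Γ⁻¹ a b : ℂ)
  have e : ∀ p : Conf n × (Conf n × Conf n), ∑ b, (Γ⁻¹ a b : ℂ) * (star (ψ p.1) * φ p.2.1 *
      (weylKernel Γ m p * ((weylPoint p b - m b : ℝ) : ℂ))) = star (ψ p.1) * φ p.2.1 *
      (weylKernel Γ m p * (((Γ⁻¹ *ᵥ (weylPoint p - m)) a : ℝ) : ℂ)) := by
    intro p
    simp only [Matrix.mulVec, dotProduct, Complex.ofReal_sum, Finset.mul_sum]
    refine Finset.sum_congr rfl fun b _ => ?_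
    simp only [Pi.sub_apply]
    push_cast
    ring
  constructor
  · exact (integrable_finsetSum Finset.univ fun b _ => hc b).congr
      (Filter.Eventually.of_forall e)
  · simp only [← e, weylMoment, ← integral_const_mul]
    exact integral_finsetSum Finset.univ fun b _ => hc b

/-- The commutator with a canonical coordinate takes the Poisson bracket of the Weyl symbol. -/
theorem weylIntegral_commutator (hΓ : Γ.PosDef) (a : PhaseIdx n) (ψ φ : 𝓢(Conf n, ℂ)) :
    weylIntegral Γ m (canonicalOp n a ψ) φ - weylIntegral Γ m ψ (canonicalOp n a φ) =
      -Complex.I * ∑ b, ((symplJ n * Γ⁻¹) a b : ℂ) * weylMoment Γ m b ψ φ := by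
  rcases a with j | j
  · have h1 := integrable_weylKernel (m := m) hΓ (canonicalOp n (Sum.inl j) ψ) φ
    have h2 := integrable_weylKernel (m := m) hΓ ψ (canonicalOp n (Sum.inl j) φ)
    obtain ⟨i3, e3⟩ := integral_weylKernel_mul_mulVec (m := m) hΓ (Sum.inr j) ψ φ
    have hJ : ∀ b, (symplJ n * Γ⁻¹) (Sum.inl j) b = Γ⁻¹ (Sum.inr j) b := fun b => by
      simp [symplJ, Matrix.mul_apply, Matrix.one_apply]
    have hadd : ∀ p : Conf n × (Conf n × Conf n), star (ψ p.1) * φ p.2.1 *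
        (Complex.I * ((p.1 j - p.2.1 j : ℝ) : ℂ) * weylKernel Γ m p -
          weylKernel Γ m p * (((Γ⁻¹ *ᵥ (weylPoint p - m)) (Sum.inr j) : ℝ) : ℂ)) =
        Complex.I * (star (canonicalOp n (Sum.inl j) ψ p.1) * φ p.2.1 * weylKernel Γ m p -
          star (ψ p.1) * canonicalOp n (Sum.inl j) φ p.2.1 * weylKernel Γ m p) -
        star (ψ p.1) * φ p.2.1 *
          (weylKernel Γ m p * (((Γ⁻¹ *ᵥ (weylPoint p - m)) (Sum.inr j) : ℝ) : ℂ)) := by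
      intro p
      simp only [canonicalOp_inl_apply, star_mul', Complex.star_def, Complex.conj_ofReal]
      push_cast
      ring
    have h12 : Integrable fun p : Conf n × (Conf n × Conf n) =>
        Complex.I * (star (canonicalOp n (Sum.inl j) ψ p.1) * φ p.2.1 * weylKernel Γ m p -
          star (ψ p.1) * canonicalOp n (Sum.inl j) φ p.2.1 * weylKernel Γ m p) :=
      (h1.sub h2).const_mul Complex.I
    -- Differentiation in `ξ_j`: the phase yields `i (x_j - y_j)`, the position commutator, and the
    -- symbol yields its `ξ_j`-derivative. The test functions do not depend on `ξ`, so there is no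
    -- other term.
    have h := integral_mul_weylKernel_lineDeriv (m := m) hΓ ψ φ
      (0, (0, EuclideanSpace.single j 1)) (k' := fun p =>
        Complex.I * ((p.1 j - p.2.1 j : ℝ) : ℂ) * weylKernel Γ m p -
          weylKernel Γ m p * (((Γ⁻¹ *ᵥ (weylPoint p - m)) (Sum.inr j) : ℝ) : ℂ)) (fun p => by
        have hz : weylPoint ((0, (0, EuclideanSpace.single j 1)) :
            Conf n × (Conf n × Conf n)) = Pi.single (Sum.inr j) 1 := by
          ext a
          rcases a with i | i <;> simp [weylPoint, Pi.single_apply]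
        rw [hz, single_dotProduct, sub_zero, inner_zero_left, EuclideanSpace.inner_single_right]
        simp
        ring) (by
          simp only [hadd]
          exact h12.sub i3)
    simp only [hadd] at h
    rw [integral_sub h12 i3, integral_const_mul, e3,
      integral_sub h1 h2] at h
    change Complex.I * (weylIntegral Γ m (canonicalOp n (Sum.inl j) ψ) φ -
      weylIntegral Γ m ψ (canonicalOp n (Sum.inl j) φ)) - _ = _ at h
    simp only [hJ]
    simp [-Fintype.sum_sum_type] at h
    linear_combination (-Complex.I) * h + (weylIntegral Γ m (canonicalOp n (Sum.inl j) ψ) φ -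
      weylIntegral Γ m ψ (canonicalOp n (Sum.inl j) φ)) * Complex.I_mul_I
  · obtain ⟨i3, e3⟩ := integral_weylKernel_mul_mulVec (m := m) hΓ (Sum.inl j) ψ φ
    have hJ : ∀ b, (symplJ n * Γ⁻¹) (Sum.inr j) b = -Γ⁻¹ (Sum.inl j) b := fun b => by
      simp [symplJ, Matrix.mul_apply, Matrix.one_apply]
    obtain ⟨e1, e2⟩ := weylIntegral_canonicalOp_inr (Γ := Γ) (m := m) j ψ φ
    -- Moving `x` and `y` together leaves the phase fixed and shifts the midpoint, so only the
    -- `x_j`-derivative of the symbol appears, against the momentum commutator.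
    have h := integral_mul_weylKernel_lineDeriv (m := m) hΓ ψ φ
      (EuclideanSpace.single j 1, (EuclideanSpace.single j 1, 0)) (k' := fun p =>
        -(weylKernel Γ m p * (((Γ⁻¹ *ᵥ (weylPoint p - m)) (Sum.inl j) : ℝ) : ℂ))) (fun p => by
        have hz : weylPoint ((EuclideanSpace.single j 1, (EuclideanSpace.single j 1, 0)) :
            Conf n × (Conf n × Conf n)) = Pi.single (Sum.inl j) 1 := by
          ext a
          rcases a with i | i
          · rcases eq_or_ne i j with rfl | hij
            · simp [weylPoint]
            · simp [weylPoint, hij]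
          · simp [weylPoint]
        rw [hz, single_dotProduct, sub_self, inner_zero_left, inner_zero_right]
        simp
        ring) (by
          simp only [mul_neg]
          exact i3.neg)
    simp only [mul_neg, integral_neg, neg_inj] at h
    rw [e3] at h
    change _ = weylIntegral Γ m (∂_{(EuclideanSpace.single j 1 : Conf n)} ψ) φ +
      weylIntegral Γ m ψ (∂_{(EuclideanSpace.single j 1 : Conf n)} φ) at h
    simp only [hJ, e1, e2]
    simp only [Complex.ofReal_neg, neg_mul, Finset.sum_neg_distrib]
    linear_combination (-Complex.I) * h

theorem IsDensityMatrix.ne_zero {Z : Type} [MeasureSpace Z] {ρ : L2 Z →L[ℂ] L2 Z}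
    (h : IsDensityMatrix ρ) : ρ ≠ 0 := by
  rintro rfl
  have := h.2
  simp only [zero_apply, inner_zero_right] at this
  exact zero_ne_one (hasSum_zero.unique this)

theorem IsGaussianState.isGaussianForm {ρ : L2 (Conf n) →L[ℂ] L2 (Conf n)}
    (h : IsGaussianState ρ Γ m) :
    IsGaussianForm (fun a => (canonicalOp n a : 𝓢(Conf n, ℂ) →ₗ[ℂ] 𝓢(Conf n, ℂ))) m (symplJ n)
      (symplJ n * Γ⁻¹) (stateForm ρ) where
  ccr a b φ := canonicalOp_ccr n a b φ
  commutator a ψ φ := by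
    have hc := fun b => symMul_weylIntegral (m := m) h.posDef b ψ φ
    have h1 := weylIntegral_commutator (m := m) h.posDef a ψ φ
    have h2 : ∀ ψ φ, stateForm ρ ψ φ =
        ((2 * Real.pi : ℝ) : ℂ)⁻¹ ^ n * weylIntegral Γ m ψ φ :=
      fun ψ φ => stateForm_eq_integral h.posDef h.symbol ψ φ
    have h3 : ∀ b, symMul (fun a => (canonicalOp n a : 𝓢(Conf n, ℂ) →ₗ[ℂ] 𝓢(Conf n, ℂ))) m b
        (fun ψ φ => stateForm ρ ψ φ) ψ φ =
        ((2 * Real.pi : ℝ) : ℂ)⁻¹ ^ n * weylMoment Γ m b ψ φ := by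
      intro b
      rw [← hc]
      simp only [symMul, h2]
      ring
    simp only [h3, ContinuousLinearMap.coe_coe]
    rw [h2, h2, ← mul_sub, h1, Finset.mul_sum, Finset.mul_sum, Finset.mul_sum]
    exact Finset.sum_congr rfl fun b _ => by ring
  ne_zero := exists_stateForm_ne_zero h.density.ne_zero

end GaussianState

/-! ### Product operators, their minors and the coupling commutator -/

section Product

variable {d N : ℕ}

theorem inner_toLp_schwartzTensor {ρ₀ : L2 (Conf d × Conf N) →L[ℂ] L2 (Conf d × Conf N)}
    {ρS : L2 (Conf d) →L[ℂ] L2 (Conf d)} {ρE : L2 (Conf N) →L[ℂ] L2 (Conf N)}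
    (hρ₀ : IsTensorOp ρ₀ ρS ρE) (ψ φ : 𝓢(Conf d, ℂ)) (χ ω : 𝓢(Conf N, ℂ)) :
    ⟪(schwartzTensor ψ χ).toLp 2 (volume : Measure (Conf d × Conf N)),
      ρ₀ ((schwartzTensor φ ω).toLp 2
          (volume : Measure (Conf d × Conf N)))⟫_ℂ = stateForm ρS ψ φ * stateForm ρE χ ω := by
  rw [toLp_schwartzTensor, toLp_schwartzTensor, hρ₀, inner_tensorVec, stateForm_apply,
    stateForm_apply]

/-- The commutator form of a product operator with the total Hamiltonian. -/
theorem inner_commutator_totalHamiltonian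
    {ρ₀ : L2 (Conf d × Conf N) →L[ℂ] L2 (Conf d × Conf N)}
    {ρS : L2 (Conf d) →L[ℂ] L2 (Conf d)} {ρE : L2 (Conf N) →L[ℂ] L2 (Conf N)}
    (hρ₀ : IsTensorOp ρ₀ ρS ρE) (MS : Matrix (PhaseIdx d) (PhaseIdx d) ℝ)
    (ME : Matrix (PhaseIdx N) (PhaseIdx N) ℝ) (G : Matrix (PhaseIdx d) (PhaseIdx N) ℝ)
    (ψ φ : 𝓢(Conf d, ℂ)) (χ ω : 𝓢(Conf N, ℂ)) :
    ⟪(totalHamiltonian MS ME G (schwartzTensor ψ χ)).toLp 2 (volume : Measure (Conf d × Conf N)),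
        ρ₀ ((schwartzTensor φ ω).toLp 2
          (volume : Measure (Conf d × Conf N)))⟫_ℂ -
      ⟪(schwartzTensor ψ χ).toLp 2 (volume : Measure (Conf d × Conf N)),
        ρ₀ ((totalHamiltonian MS ME G (schwartzTensor φ ω)).toLp 2
          (volume : Measure (Conf d × Conf N)))⟫_ℂ =
    (stateForm ρS (weylQuadratic (canonicalOp d) MS ψ) φ -
        stateForm ρS ψ (weylQuadratic (canonicalOp d) MS φ)) * stateForm ρE χ ω +
      stateForm ρS ψ φ * (stateForm ρE (weylQuadratic (canonicalOp N) ME χ) ω -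
        stateForm ρE χ (weylQuadratic (canonicalOp N) ME ω)) +
      ∑ a, ∑ b, (G a b : ℂ) * (stateForm ρS (canonicalOp d a ψ) φ *
          stateForm ρE (canonicalOp N b χ) ω -
        stateForm ρS ψ (canonicalOp d a φ) * stateForm ρE χ (canonicalOp N b ω)) := by
  have hin : ∀ (ψ φ : 𝓢(Conf d, ℂ)) (χ ω : 𝓢(Conf N, ℂ)),
      ⟪SchwartzMap.toLpCLM ℂ ℂ 2 (volume : Measure (Conf d × Conf N)) (schwartzTensor ψ χ),
        ρ₀ (SchwartzMap.toLpCLM ℂ ℂ 2 (volume : Measure (Conf d × Conf N))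
          (schwartzTensor φ ω))⟫_ℂ = stateForm ρS ψ φ * stateForm ρE χ ω :=
    fun ψ φ χ ω => by
      rw [SchwartzMap.toLpCLM_apply, SchwartzMap.toLpCLM_apply]
      exact inner_toLp_schwartzTensor hρ₀ ψ φ χ ω
  simp only [← SchwartzMap.toLpCLM_apply (𝕜 := ℂ), totalHamiltonian_schwartzTensor, map_add,
    map_sum, map_smul, inner_add_left, inner_add_right, sum_inner, inner_sum, inner_smul_left,
    inner_smul_right, hin, Complex.conj_ofReal, mul_sub, Finset.sum_sub_distrib]
  ring

theorem sum_symplJ_mul_eq_zero (n : ℕ) (x : PhaseIdx n → ℂ)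
    (h : ∀ a, ∑ c, (symplJ n a c : ℂ) * x c = 0) : x = 0 := by
  ext a
  rcases a with j | j
  · simpa [symplJ, Matrix.one_apply, apply_ite (Complex.ofReal)] using h (Sum.inr j)
  · simpa [symplJ, Matrix.one_apply, apply_ite (Complex.ofReal)] using h (Sum.inl j)

theorem symplJ_mul_self (n : ℕ) : symplJ n * symplJ n = -1 := by
  simp [symplJ, Matrix.fromBlocks_multiply, ← Matrix.fromBlocks_one, Matrix.fromBlocks_neg]

theorem symplJ_transpose (n : ℕ) : (symplJ n)ᵀ = -symplJ n := by
  simp [symplJ, Matrix.fromBlocks_transpose, Matrix.fromBlocks_neg]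

/-- The bilinear part of the commutator form, in terms of symmetrized moments. -/
theorem IsGaussianForm.sum_commutator_eq {V W κ ι : Type*} [AddCommGroup V] [Module ℂ V]
    [AddCommGroup W] [Module ℂ W] [Fintype κ] [Fintype ι] {Q : κ → V →ₗ[ℂ] V}
    {P : ι → W →ₗ[ℂ] W} {m : κ → ℝ} {n : ι → ℝ} {J K : Matrix κ κ ℝ} {J' L : Matrix ι ι ℝ}
    {r : V →ₗ⋆[ℂ] V →ₗ[ℂ] ℂ} {s : W →ₗ⋆[ℂ] W →ₗ[ℂ] ℂ} (h : IsGaussianForm Q m J K r)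
    (h' : IsGaussianForm P n J' L s) (G : Matrix κ ι ℝ) (ψ φ : V) (χ ω : W) :
    ∑ a, ∑ b, (G a b : ℂ) * (r (Q a ψ) φ * s (P b χ) ω - r ψ (Q a φ) * s χ (P b ω)) =
      -Complex.I * ∑ c, ∑ e, ((G * L + Kᵀ * G) c e : ℂ) *
        (symMul Q m c (fun ψ φ => r ψ φ) ψ φ * symMul P n e (fun ψ φ => s ψ φ) χ ω) +
      (∑ a, ∑ b, (G a b : ℂ) * n b * (r (Q a ψ) φ - r ψ (Q a φ))) * s χ ω +
      r ψ φ * ∑ a, ∑ b, (G a b : ℂ) * m a * (s (P b χ) ω - s χ (P b ω)) := by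
  set D := fun c => symMul Q m c (fun ψ φ => r ψ φ) ψ φ with hD
  set F := fun e => symMul P n e (fun ψ φ => s ψ φ) χ ω with hF
  -- The split is `x y - x' y' = (x + x')/2 * (y - y') + (x - x') * (y + y')/2`. Each average is a
  -- symmetrized moment plus the mean times the form; the mean parts are the tangent terms of the
  -- statement, and each difference is expanded by the Gaussian relation.
  have hG1 : ∑ a, ∑ b, (G a b : ℂ) * (D a * (s (P b χ) ω - s χ (P b ω))) =
      -Complex.I * ∑ c, ∑ e, ((G * L) c e : ℂ) * (D c * F e) := by
    simp only [h'.commutator, Matrix.mul_apply, Complex.ofReal_sum, Complex.ofReal_mul,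
      Finset.sum_mul, Finset.mul_sum]
    refine Finset.sum_congr rfl fun a _ => ?_
    rw [Finset.sum_comm]
    exact Finset.sum_congr rfl fun e _ => Finset.sum_congr rfl fun b _ => by ring
  have hG2 : ∑ a, ∑ b, (G a b : ℂ) * ((r (Q a ψ) φ - r ψ (Q a φ)) * F b) =
      -Complex.I * ∑ c, ∑ e, ((Kᵀ * G) c e : ℂ) * (D c * F e) := by
    simp only [h.commutator, Matrix.mul_apply, Matrix.transpose_apply, Complex.ofReal_sum,
      Complex.ofReal_mul, Finset.sum_mul, Finset.mul_sum]
    have e1 : ∀ a, ∑ b, ∑ c, (G a b : ℂ) * (-Complex.I * ((K a c : ℂ) *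
        symMul Q m c (fun ψ φ => r ψ φ) ψ φ) * F b) = ∑ c, ∑ b, (G a b : ℂ) *
        (-Complex.I * ((K a c : ℂ) * symMul Q m c (fun ψ φ => r ψ φ) ψ φ) * F b) :=
      fun a => Finset.sum_comm
    simp only [e1]
    rw [Finset.sum_comm]
    refine Finset.sum_congr rfl fun c _ => ?_
    rw [Finset.sum_comm]
    exact Finset.sum_congr rfl fun e _ => Finset.sum_congr rfl fun b _ => by ring
  have hadd : ∑ c, ∑ e, ((G * L + Kᵀ * G) c e : ℂ) * (D c * F e) =
      ∑ c, ∑ e, ((G * L) c e : ℂ) * (D c * F e) +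
        ∑ c, ∑ e, ((Kᵀ * G) c e : ℂ) * (D c * F e) := by
    simp only [Matrix.add_apply, Complex.ofReal_add, add_mul, Finset.sum_add_distrib]
  rw [hadd, mul_add, ← hG1, ← hG2]
  simp only [Finset.sum_mul, Finset.mul_sum, ← Finset.sum_add_distrib]
  refine Finset.sum_congr rfl fun a _ => Finset.sum_congr rfl fun b _ => ?_
  simp only [hD, hF, symMul]
  ring

/-- A `2 × 2` minor of a product operator with respect to product vectors vanishes. -/
theorem IsTensorOp.minor_eq_zero {T : L2 (Conf d × Conf N) →L[ℂ] L2 (Conf d × Conf N)}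
    {A : L2 (Conf d) →L[ℂ] L2 (Conf d)} {B : L2 (Conf N) →L[ℂ] L2 (Conf N)}
    (hT : IsTensorOp T A B) (ψ φ ψ' φ' : 𝓢(Conf d, ℂ)) (χ ω χ' ω' : 𝓢(Conf N, ℂ)) :
    ⟪(schwartzTensor ψ χ).toLp 2 (volume : Measure (Conf d × Conf N)),
        T ((schwartzTensor φ ω).toLp 2
          (volume : Measure (Conf d × Conf N)))⟫_ℂ *
      ⟪(schwartzTensor ψ' χ').toLp 2 (volume : Measure (Conf d × Conf N)),
        T ((schwartzTensor φ' ω').toLp 2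
          (volume : Measure (Conf d × Conf N)))⟫_ℂ -
    ⟪(schwartzTensor ψ χ').toLp 2 (volume : Measure (Conf d × Conf N)),
        T ((schwartzTensor φ ω').toLp 2
          (volume : Measure (Conf d × Conf N)))⟫_ℂ *
      ⟪(schwartzTensor ψ' χ).toLp 2 (volume : Measure (Conf d × Conf N)),
        T ((schwartzTensor φ' ω).toLp 2
          (volume : Measure (Conf d × Conf N)))⟫_ℂ = 0 := by
  simp only [inner_toLp_schwartzTensor hT]
  ring

/-- A nonzero derivative would keep `f` away from any given value on a punctured neighbourhood of 0.
-/
theorem HasDerivAt.eq_zero_of_frequently_eq {f : ℝ → ℂ} {f' c : ℂ} (hf : HasDerivAt f f' 0)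
    (h : ∀ ε : ℝ, 0 < ε → ∃ t ∈ Set.Ioc 0 ε, f t = c) : f' = 0 := by
  by_contra hne
  have hev := hf.eventually_ne (c := c) hne
  rw [eventually_nhdsWithin_iff, Metric.eventually_nhds_iff] at hev
  obtain ⟨δ, hδ, hev⟩ := hev
  obtain ⟨t, ht, hft⟩ := h (δ / 2) (half_pos hδ)
  refine hev ?_ (ne_of_gt ht.1) hft
  rw [Real.dist_eq, sub_zero, abs_of_pos ht.1]
  linarith [ht.2]

/-- Since `(JΓ_S⁻¹)ᵀ = -Γ_S⁻¹ J` and `J² = -1`, left multiplication by `JΓ_S` turns the second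
summand into `G`. -/
theorem matrix_condition_of_eq_zero {ΓS : Matrix (PhaseIdx d) (PhaseIdx d) ℝ} (hS : ΓS.PosDef)
    {ΓE : Matrix (PhaseIdx N) (PhaseIdx N) ℝ} {G : Matrix (PhaseIdx d) (PhaseIdx N) ℝ}
    (h : G * (symplJ N * ΓE⁻¹) + (symplJ d * ΓS⁻¹)ᵀ * G = 0) :
    symplJ d * ΓS * G * symplJ N * ΓE⁻¹ + G = 0 := by
  have ht : (ΓS⁻¹)ᵀ = ΓS⁻¹ := by
    have := hS.inv.isHermitian.eq
    rwa [Matrix.conjTranspose_eq_transpose_of_trivial] at this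
  have hu : ΓS * ΓS⁻¹ = 1 := Matrix.mul_nonsing_inv _ hS.det_pos.ne'.isUnit
  rw [Matrix.transpose_mul, ht, symplJ_transpose] at h
  have h2 := congrArg (fun X => symplJ d * ΓS * X) h
  simp only [Matrix.mul_add, Matrix.mul_zero] at h2
  have h3 : symplJ d * ΓS * (ΓS⁻¹ * -symplJ d * G) = G := by
    calc symplJ d * ΓS * (ΓS⁻¹ * -symplJ d * G)
        = symplJ d * (ΓS * ΓS⁻¹) * -symplJ d * G := by simp only [Matrix.mul_assoc]
      _ = G := by rw [hu, Matrix.mul_one, Matrix.mul_neg, symplJ_mul_self, neg_neg, Matrix.one_mul]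
  rw [h3] at h2
  simpa only [Matrix.mul_assoc] using h2

end Product

/-! ### Conclusion: the evolved state leaves the product operators -/

/-- For small positive times the evolved state is not a product of any two bounded operators,
whichever factors are chosen. -/
theorem exists_forall_not_isTensorOp_evolvedState (d N : ℕ)
    (MS : ℝ → Matrix (PhaseIdx d) (PhaseIdx d) ℝ) (hMS : Continuous MS)
    (ME : ℝ → Matrix (PhaseIdx N) (PhaseIdx N) ℝ) (hME : Continuous ME)
    (G : ℝ → Matrix (PhaseIdx d) (PhaseIdx N) ℝ) (hG : Continuous G)
    (U : ℝ → L2 (Conf d × Conf N) →L[ℂ] L2 (Conf d × Conf N))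
    (hU : IsPropagator (fun t => totalHamiltonian (MS t) (ME t) (G t)) U)
    (ΓS : Matrix (PhaseIdx d) (PhaseIdx d) ℝ) (mS : PhaseIdx d → ℝ)
    (ΓE : Matrix (PhaseIdx N) (PhaseIdx N) ℝ) (mE : PhaseIdx N → ℝ)
    (ρS : L2 (Conf d) →L[ℂ] L2 (Conf d)) (hρS : IsGaussianState ρS ΓS mS)
    (ρE : L2 (Conf N) →L[ℂ] L2 (Conf N)) (hρE : IsGaussianState ρE ΓE mE)
    (ρ₀ : L2 (Conf d × Conf N) →L[ℂ] L2 (Conf d × Conf N)) (hρ₀ : IsTensorOp ρ₀ ρS ρE)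
    (hcond : symplJ d * ΓS * G 0 * symplJ N * ΓE⁻¹ + G 0 ≠ 0) :
    ∃ ε : ℝ, 0 < ε ∧ ∀ t ∈ Set.Ioc 0 ε,
      ∀ A B, ¬ IsTensorOp (evolvedState U ρ₀ t) A B := by
  by_contra! hcon
  have hr := hρS.isGaussianForm
  have hs := hρE.isGaussianForm
  obtain ⟨ψ', φ', hr0⟩ := hr.ne_zero
  obtain ⟨χ', ω', hs0⟩ := hs.ne_zero
  have hz : U 0 = 1 := hU.zero
  have hT0 : evolvedState U ρ₀ 0 = ρ₀ := by
    rw [evolvedState, hz, ← ContinuousLinearMap.star_eq_adjoint, star_one]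
    rfl
  set T' := fun (ψ φ : 𝓢(Conf d, ℂ)) (χ ω : 𝓢(Conf N, ℂ)) => -Complex.I *
    (⟪(totalHamiltonian (MS 0) (ME 0) (G 0) (schwartzTensor ψ χ)).toLp 2
        (volume : Measure (Conf d × Conf N)), ρ₀ ((schwartzTensor φ ω).toLp 2
          (volume : Measure (Conf d × Conf N)))⟫_ℂ -
      ⟪(schwartzTensor ψ χ).toLp 2 (volume : Measure (Conf d × Conf N)),
        ρ₀ ((totalHamiltonian (MS 0) (ME 0) (G 0) (schwartzTensor φ ω)).toLp 2
          (volume : Measure (Conf d × Conf N)))⟫_ℂ) with hT'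
  have hder : ∀ ψ φ χ ω, HasDerivAt (fun t => ⟪(schwartzTensor ψ χ).toLp 2
      (volume : Measure (Conf d × Conf N)),
      evolvedState U ρ₀ t ((schwartzTensor φ ω).toLp 2
          (volume : Measure (Conf d × Conf N)))⟫_ℂ) (T' ψ φ χ ω) 0 := fun ψ φ χ ω =>
    hU.hasDerivAt_evolvedState ρ₀ _ _ (exists_norm_totalHamiltonian_le hMS hME hG)
  -- The minor with reference vectors `ψ'`, `φ'`, `χ'`, `ω'` vanishes at arbitrarily small positive
  -- times, so its derivative at 0, given by the product rule, is zero.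
  have hminor : ∀ ψ φ χ ω, T' ψ φ χ ω * (stateForm ρS ψ' φ' * stateForm ρE χ' ω') +
      stateForm ρS ψ φ * stateForm ρE χ ω * T' ψ' φ' χ' ω' -
      (T' ψ φ χ' ω' * (stateForm ρS ψ' φ' * stateForm ρE χ ω) +
        stateForm ρS ψ φ * stateForm ρE χ' ω' * T' ψ' φ' χ ω) = 0 := by
    intro ψ φ χ ω
    have h := ((hder ψ φ χ ω).mul (hder ψ' φ' χ' ω')).sub
      ((hder ψ φ χ' ω').mul (hder ψ' φ' χ ω))
    simp only [hT0, inner_toLp_schwartzTensor hρ₀] at h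
    refine h.eq_zero_of_frequently_eq (c := 0) fun ε hε => ?_
    obtain ⟨t, ht, A, B, hprod⟩ := hcon ε hε
    exact ⟨t, ht, hprod.minor_eq_zero ψ φ ψ' φ' χ ω χ' ω'⟩
  -- Both reference matrix elements are nonzero, so the differentiated minor can be solved for `T'`,
  -- which exhibits it as tangent to the product forms.
  have htan : ∀ ψ φ χ ω, T' ψ φ χ ω = (T' ψ φ χ' ω' / stateForm ρE χ' ω' - stateForm ρS ψ φ *
      T' ψ' φ' χ' ω' / (stateForm ρS ψ' φ' * stateForm ρE χ' ω')) * stateForm ρE χ ω +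
      stateForm ρS ψ φ * (T' ψ' φ' χ ω / stateForm ρS ψ' φ') := by
    intro ψ φ χ ω
    have := hminor ψ φ χ ω
    field_simp
    linear_combination this
  -- The forms `α` and `β` collect everything tangent: the two parts of `T'` from `htan`, the local
  -- Hamiltonians and the terms carrying the means. The two factors `-i`, from the Schrödinger
  -- equation and from the Gaussian relation, multiply to `-1`, whence the signs.
  have hM := hr.eq_zero_of_tangent hs (sum_symplJ_mul_eq_zero d) (sum_symplJ_mul_eq_zero N)
    (M := (G 0 * (symplJ N * ΓE⁻¹) + (symplJ d * ΓS⁻¹)ᵀ * G 0).map Complex.ofReal)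
    (α := fun ψ φ => -(T' ψ φ χ' ω' / stateForm ρE χ' ω' - stateForm ρS ψ φ *
        T' ψ' φ' χ' ω' / (stateForm ρS ψ' φ' * stateForm ρE χ' ω')) -
      Complex.I * (stateForm ρS (weylQuadratic (canonicalOp d) (MS 0) ψ) φ -
        stateForm ρS ψ (weylQuadratic (canonicalOp d) (MS 0) φ) +
        ∑ a, ∑ b, (G 0 a b : ℂ) * mE b *
          (stateForm ρS (canonicalOp d a ψ) φ - stateForm ρS ψ (canonicalOp d a φ))))
    (β := fun χ ω => -(T' ψ' φ' χ ω / stateForm ρS ψ' φ') -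
      Complex.I * (stateForm ρE (weylQuadratic (canonicalOp N) (ME 0) χ) ω -
        stateForm ρE χ (weylQuadratic (canonicalOp N) (ME 0) ω) +
        ∑ a, ∑ b, (G 0 a b : ℂ) * mS a *
          (stateForm ρE (canonicalOp N b χ) ω - stateForm ρE χ (canonicalOp N b ω))))
    (fun ψ φ χ ω => by
      have h1 := inner_commutator_totalHamiltonian hρ₀ (MS 0) (ME 0) (G 0) ψ φ χ ω
      have h2 := hr.sum_commutator_eq hs (G 0) ψ φ χ ω
      have h3 := htan ψ φ χ ω
      have h4 : T' ψ φ χ ω = -Complex.I * _ := congrArg (-Complex.I * ·) h1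
      simp only [ContinuousLinearMap.coe_coe] at h2
      rw [h2] at h4
      simp only [Matrix.map_apply]
      linear_combination h4 - h3 + (∑ c, ∑ e,
        ((G 0 * (symplJ N * ΓE⁻¹) + (symplJ d * ΓS⁻¹)ᵀ * G 0) c e : ℂ) *
          (symMul (fun a => (canonicalOp d a : 𝓢(Conf d, ℂ) →ₗ[ℂ] 𝓢(Conf d, ℂ))) mS c
              (fun ψ φ => stateForm ρS ψ φ) ψ φ *
            symMul (fun b => (canonicalOp N b : 𝓢(Conf N, ℂ) →ₗ[ℂ] 𝓢(Conf N, ℂ))) mE e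
              (fun ψ φ => stateForm ρE ψ φ) χ ω)) * Complex.I_mul_I)
  refine hcond (matrix_condition_of_eq_zero hρS.posDef ?_)
  ext a b
  exact Complex.ofReal_injective (by simpa using congrFun (congrFun hM a) b)

/-- The reduced states are one particular choice of factors, so no convergence property of the
partial traces is required. -/
theorem mainTheorem9 (d N : ℕ)
    (MS : ℝ → Matrix (PhaseIdx d) (PhaseIdx d) ℝ) (hMS : Continuous MS)
    (ME : ℝ → Matrix (PhaseIdx N) (PhaseIdx N) ℝ) (hME : Continuous ME)
    (G : ℝ → Matrix (PhaseIdx d) (PhaseIdx N) ℝ) (hG : Continuous G)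
    (U : ℝ → L2 (Conf d × Conf N) →L[ℂ] L2 (Conf d × Conf N))
    (hU : IsPropagator (fun t => totalHamiltonian (MS t) (ME t) (G t)) U)
    (ΓS : Matrix (PhaseIdx d) (PhaseIdx d) ℝ) (mS : PhaseIdx d → ℝ)
    (ΓE : Matrix (PhaseIdx N) (PhaseIdx N) ℝ) (mE : PhaseIdx N → ℝ)
    (ρS : L2 (Conf d) →L[ℂ] L2 (Conf d)) (hρS : IsGaussianState ρS ΓS mS)
    (ρE : L2 (Conf N) →L[ℂ] L2 (Conf N)) (hρE : IsGaussianState ρE ΓE mE)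
    (ρ₀ : L2 (Conf d × Conf N) →L[ℂ] L2 (Conf d × Conf N)) (hρ₀ : IsTensorOp ρ₀ ρS ρE)
    (hcond : symplJ d * ΓS * G 0 * symplJ N * ΓE⁻¹ + G 0 ≠ 0) :
    ∃ ε : ℝ, 0 < ε ∧ ∀ t ∈ Set.Ioc 0 ε,
      ¬ IsTensorOp (evolvedState U ρ₀ t)
        (partialTraceSnd (evolvedState U ρ₀ t)) (partialTraceFst (evolvedState U ρ₀ t)) := by
  obtain ⟨ε, hε, h⟩ := exists_forall_not_isTensorOp_evolvedState d N MS hMS ME hME G hG U hU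
    ΓS mS ΓE mE ρS hρS ρE hρE ρ₀ hρ₀ hcond
  exact ⟨ε, hε, fun t ht => h t ht _ _⟩
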